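/- **Setting.** Let $N$ be a smooth $(2n+1)$-dimensional manifold. An almost contact metric structure $(\phi,\xi,\eta,g)$ on $N$ consists of a smooth $(1,1)$-tensor field $\phi$, a vector field $\xi$, a $1$-form $\eta$ and a Riemannian metric $g$ with $$\phi^2=-I+\eta\otimes\xi,\qquad \eta(\xi)=1,\qquad g(\phi X,\phi Y)=g(X,Y)-\eta(X)\eta(Y).$$ Its fundamental $2$-form is $\Phi(X,Y)=g(X,\phi Y)$. The structure is *cosymplectic* if $d\eta=0$, $d\Phi=0$, and it is normal, that is, for all vector fields $X,Y$, $$\phi^2[X,Y]+[\phi X,\phi Y]-\phi[\phi X,Y]-\phi[X,\phi Y]+\big(X\eta(Y)-Y\eta(X)-\eta([X,Y])\big)\xi=0 .$$ Let $M$ be an immersed submanifold of $N$, and write $M_p=\{X\in T_pM: g(X,\xi)=0\}$. $M$ is *proper pointwise slant* if there is a function $\theta:M\to[0,\frac{\pi}{2})$ such that for every $p\in M$ and every nonzero $X\in M_p$ the angle between $\phi X$ and the subspace $M_p$ is $\theta(p)$. For $X$ tangent to $M$ let $TX$ be the tangential part of $\phi X$, put $\Omega(X,Y)=g(X,TY)$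 for $X,Y$ tangent to $M$, and denote the restriction of $\eta$ to $M$ again by $\eta$. **Theorem.** Let $(N,\phi,\xi,\eta,g)$ be a $(2n+1)$-dimensional cosymplectic manifold and let $M$ be a nonempty compact $(2m+1)$-dimensional (without boundary) proper pointwise slant immersed submanifold of $N$ such that $\xi$ is tangent to $M$. Then: 1. $\eta$ is a closed $1$-form on $M$, and its de Rham class $[\eta]\in H^1(M,\mathbb{R})$ is nonzero; 2. $\Omega$ is a closed $2$-form on $M$, and if $m\ge 1$ its de Rham class $[\Omega]\in H^2(M,\mathbb{R})$ is nonzero; 3. $\eta\wedge\Omega^m$ is a volume form on $M$, that is, a smooth form of degree $2m+1$ that vanishes at no point; 4. $H^i(M,\mathbb{R})\neq 0$ for all $0\le i\le 2m+1$. -/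

import Mathlib

open Bundle
open scoped Manifold ContDiff Topology

noncomputable section

namespace PointwiseSlant

/-! ### Exterior algebra of a vector space -/

section Wedge

variable {V : Type*} [AddCommGroup V] [Module ℝ V] [TopologicalSpace V]

/-- The tensor product `(v₁, …, v_{k+l}) ↦ α (v₁, …, v_k) * β (v_{k+1}, …, v_{k+l})`. -/
def tensor {k l : ℕ} (α : V [⋀^Fin k]→L[ℝ] ℝ) (β : V [⋀^Fin l]→L[ℝ] ℝ) :
    ContinuousMultilinearMap ℝ (fun _ : Fin (k + l) => V) ℝ where
  toMultilinearMap :=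
    ((LinearMap.mul' ℝ ℝ).compMultilinearMap
      (MultilinearMap.domCoprod α.toMultilinearMap β.toMultilinearMap)).domDomCongr finSumFinEquiv
  cont := by
    have h : Continuous fun v : Fin (k + l) → V =>
        α (fun i => v (Fin.castAdd l i)) * β (fun j => v (Fin.natAdd k j)) :=
      (α.cont.comp (continuous_pi fun i => continuous_apply _)).mul
        (β.cont.comp (continuous_pi fun i => continuous_apply _))
    refine h.congr fun v => ?_
    simp

theorem tensor_apply {k l : ℕ} (α : V [⋀^Fin k]→L[ℝ] ℝ) (β : V [⋀^Fin l]→L[ℝ] ℝ)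
    (v : Fin (k + l) → V) :
    tensor α β v = α (fun i => v (Fin.castAdd l i)) * β (fun j => v (Fin.natAdd k j)) := by
  rw [← ContinuousMultilinearMap.coe_coe, tensor]
  simp

/-- The wedge product
`(α ∧ β)(v₁, …) = (1 / (k! l!)) ∑_σ sign σ · α (v_{σ 1}, …, v_{σ k}) β (v_{σ (k+1)}, …)`. -/
def wedge [IsTopologicalAddGroup V] [ContinuousConstSMul ℝ V] {k l : ℕ}
    (α : V [⋀^Fin k]→L[ℝ] ℝ) (β : V [⋀^Fin l]→L[ℝ] ℝ) : V [⋀^Fin (k + l)]→L[ℝ] ℝ :=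
  ((k.factorial * l.factorial : ℕ) : ℝ)⁻¹ • ContinuousMultilinearMap.alternatization (tensor α β)

/-- The wedge power `τ ∧ ⋯ ∧ τ` (`j` factors) of a `k`-form; the empty product is `1`. -/
def wedgePow [IsTopologicalAddGroup V] [ContinuousConstSMul ℝ V] {k : ℕ}
    (τ : V [⋀^Fin k]→L[ℝ] ℝ) : (j : ℕ) → V [⋀^Fin (k * j)]→L[ℝ] ℝ
  | 0 => haveI : IsEmpty (Fin (k * 0)) := Fin.isEmpty'
    ContinuousAlternatingMap.constOfIsEmpty ℝ V (Fin (k * 0)) 1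
  | j + 1 => wedge (wedgePow τ j) τ

end Wedge

/-! ### Differential forms and de Rham cohomology of a smooth manifold without boundary -/

section DeRham

variable {E : Type*} [NormedAddCommGroup E] [NormedSpace ℝ E]
  {M : Type*} [TopologicalSpace M] [ChartedSpace E M]

variable (E M) in
/-- A (not necessarily smooth) differential `k`-form: an alternating `k`-linear form on each
tangent space. -/
def Form (k : ℕ) : Type _ := ∀ x : M, TangentSpace 𝓘(ℝ, E) x [⋀^Fin k]→L[ℝ] ℝ

instance (k : ℕ) : AddCommGroup (Form E M k) :=
  inferInstanceAs (AddCommGroup (∀ x : M, TangentSpace 𝓘(ℝ, E) x [⋀^Fin k]→L[ℝ] ℝ))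

instance (k : ℕ) : Module ℝ (Form E M k) :=
  inferInstanceAs (Module ℝ (∀ x : M, TangentSpace 𝓘(ℝ, E) x [⋀^Fin k]→L[ℝ] ℝ))

/-- The expression of a form in the chart around `x₀`: its pullback by the inverse chart, a form on
the target of the chart, which is an open subset of the model space `E`. -/
def Form.inChart {k : ℕ} (τ : Form E M k) (x₀ : M) (y : E) : E [⋀^Fin k]→L[ℝ] ℝ :=
  (τ ((extChartAt 𝓘(ℝ, E) x₀).symm y)).compContinuousLinearMap
    (mfderiv 𝓘(ℝ, E) 𝓘(ℝ, E) (extChartAt 𝓘(ℝ, E) x₀).symm y)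

/-- The exterior derivative: computed in the chart around `x`, and carried back to the tangent
space at `x` by the derivative of the chart. -/
def Form.d {k : ℕ} (τ : Form E M k) : Form E M (k + 1) := fun x =>
  (extDeriv (τ.inChart x) (extChartAt 𝓘(ℝ, E) x x)).compContinuousLinearMap
    (mfderiv 𝓘(ℝ, E) 𝓘(ℝ, E) (extChartAt 𝓘(ℝ, E) x) x)

theorem Form.inChart_add {k : ℕ} (α β : Form E M k) (x : M) :
    Form.inChart (α + β) x = Form.inChart α x + Form.inChart β x := rfl

theorem Form.inChart_smul {k : ℕ} (c : ℝ) (α : Form E M k) (x : M) :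
    Form.inChart (c • α) x = c • Form.inChart α x := rfl

variable (E M) in
/-- The space `Ω^k(M)` of smooth `k`-forms. -/
def smoothForms (k : ℕ) : Submodule ℝ (Form E M k) where
  carrier := {τ | ∀ x₀ : M, ContDiffOn ℝ ∞ (τ.inChart x₀) (extChartAt 𝓘(ℝ, E) x₀).target}
  add_mem' hα hβ x := by
    rw [Form.inChart_add]
    exact (hα x).add (hβ x)
  zero_mem' x := by
    have h : Form.inChart (0 : Form E M k) x = fun _ => 0 := rfl
    rw [h]
    exact contDiffOn_const
  smul_mem' c α hα x := by
    rw [Form.inChart_smul]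
    exact contDiffOn_const.smul (hα x)

theorem differentiableAt_inChart {k : ℕ} {τ : Form E M k} (h : τ ∈ smoothForms E M k) (x : M) :
    DifferentiableAt ℝ (τ.inChart x) (extChartAt 𝓘(ℝ, E) x x) :=
  ((h x).contDiffAt (extChartAt_target_mem_nhds x)).differentiableAt (by simp)

theorem Form.d_add {k : ℕ} {α β : Form E M k} (hα : α ∈ smoothForms E M k)
    (hβ : β ∈ smoothForms E M k) : Form.d (α + β) = Form.d α + Form.d β := by
  funext x
  rw [Form.d, Form.inChart_add,
    extDeriv_add (differentiableAt_inChart hα x) (differentiableAt_inChart hβ x)]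
  rfl

theorem Form.d_smul {k : ℕ} (c : ℝ) (α : Form E M k) : Form.d (c • α) = c • Form.d α := by
  funext x
  rw [Form.d, Form.inChart_smul, extDeriv_smul]
  rfl

theorem Form.d_zero {k : ℕ} : Form.d (0 : Form E M k) = 0 := by
  have h := Form.d_smul (0 : ℝ) (0 : Form E M k)
  rwa [zero_smul, zero_smul] at h

variable (E M) in
/-- The closed smooth `k`-forms. -/
def closedForms (k : ℕ) : Submodule ℝ (Form E M k) where
  carrier := {τ | τ ∈ smoothForms E M k ∧ τ.d = 0}
  add_mem' hα hβ := ⟨add_mem hα.1 hβ.1, by rw [Form.d_add hα.1 hβ.1, hα.2, hβ.2, add_zero]⟩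
  zero_mem' := ⟨zero_mem _, Form.d_zero⟩
  smul_mem' c α hα := ⟨Submodule.smul_mem _ c hα.1, by rw [Form.d_smul, hα.2, smul_zero]⟩

variable (E M) in
/-- The exact smooth `k`-forms: the exterior derivatives of smooth `(k - 1)`-forms;
only `0` if `k = 0`. -/
def exactForms : (k : ℕ) → Submodule ℝ (Form E M k)
  | 0 => ⊥
  | k + 1 =>
    { carrier := {τ | τ ∈ smoothForms E M (k + 1) ∧ ∃ α ∈ smoothForms E M k, Form.d α = τ}
      add_mem' := by
        rintro _ _ ⟨h₁, α, hα, rfl⟩ ⟨h₂, β, hβ, rfl⟩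
        exact ⟨add_mem h₁ h₂, α + β, add_mem hα hβ, Form.d_add hα hβ⟩
      zero_mem' := ⟨zero_mem _, 0, zero_mem _, Form.d_zero⟩
      smul_mem' := by
        rintro c _ ⟨h₁, α, hα, rfl⟩
        exact ⟨Submodule.smul_mem _ c h₁, c • α, Submodule.smul_mem _ c hα, Form.d_smul c α⟩ }

variable (E M) in
/-- The de Rham cohomology `H^k(M, ℝ)`: closed smooth `k`-forms modulo exact ones. -/
abbrev DeRhamCohomology (k : ℕ) : Type _ :=
  closedForms E M k ⧸ (exactForms E M k).comap (closedForms E M k).subtype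

/-- The de Rham cohomology class of a closed form. -/
def deRhamClass {k : ℕ} (τ : Form E M k) (hτ : τ ∈ closedForms E M k) : DeRhamCohomology E M k :=
  Submodule.Quotient.mk ⟨τ, hτ⟩

/-- The pullback of a form by a map between manifolds. -/
def Form.pullback {E' : Type*} [NormedAddCommGroup E'] [NormedSpace ℝ E']
    {N : Type*} [TopologicalSpace N] [ChartedSpace E' N] {k : ℕ} (τ : Form E' N k) (f : M → N) :
    Form E M k := fun p =>
  (τ (f p)).compContinuousLinearMap (mfderiv 𝓘(ℝ, E) 𝓘(ℝ, E') f p)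

/-- The pointwise wedge product of forms. -/
def Form.wedge {k l : ℕ} (α : Form E M k) (β : Form E M l) : Form E M (k + l) := fun x =>
  PointwiseSlant.wedge (α x) (β x)

/-- The pointwise wedge power `τ^j` of a form. -/
def Form.wedgePow {k : ℕ} (τ : Form E M k) (j : ℕ) : Form E M (k * j) := fun x =>
  PointwiseSlant.wedgePow (τ x) j

end DeRham

/-! ### Almost contact metric structures and cosymplectic manifolds -/

section AlmostContact

variable (E : Type*) [NormedAddCommGroup E] [NormedSpace ℝ E]
  (N : Type*) [TopologicalSpace N] [ChartedSpace E N] [IsManifold 𝓘(ℝ, E) ∞ N]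
  [RiemannianBundle (fun x : N => TangentSpace 𝓘(ℝ, E) x)]

/-- An almost contact metric structure `(φ, ξ, η, g)` on `N`, where `g` is the given Riemannian
metric. -/
structure AlmostContactMetricStructure where
  /-- the `(1,1)`-tensor field -/
  φ : ∀ x : N, TangentSpace 𝓘(ℝ, E) x →L[ℝ] TangentSpace 𝓘(ℝ, E) x
  /-- the characteristic vector field -/
  ξ : ∀ x : N, TangentSpace 𝓘(ℝ, E) x
  /-- the `1`-form -/
  η : ∀ x : N, TangentSpace 𝓘(ℝ, E) x →L[ℝ] ℝ
  contMDiff_φ : ContMDiff 𝓘(ℝ, E) (𝓘(ℝ, E).prod 𝓘(ℝ, E →L[ℝ] E)) ∞ fun x : N =>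
    Bundle.TotalSpace.mk' (E →L[ℝ] E)
      (E := fun x : N => TangentSpace 𝓘(ℝ, E) x →L[ℝ] TangentSpace 𝓘(ℝ, E) x) x (φ x)
  contMDiff_ξ : ContMDiff 𝓘(ℝ, E) 𝓘(ℝ, E).tangent ∞ fun x : N =>
    (⟨x, ξ x⟩ : TangentBundle 𝓘(ℝ, E) N)
  smooth_η : (fun x => ContinuousAlternatingMap.ofSubsingleton ℝ _ ℝ (0 : Fin 1) (η x)) ∈
    smoothForms E N 1
  φ_φ : ∀ x X, φ x (φ x X) = -X + η x X • ξ x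
  η_ξ : ∀ x, η x (ξ x) = 1
  inner_φ_φ : ∀ x X Y, inner ℝ (φ x X) (φ x Y) = inner ℝ X Y - η x X * η x Y

namespace AlmostContactMetricStructure

variable {E N} (S : AlmostContactMetricStructure E N)

/-- `η` as a differential form of degree one. -/
def etaForm : Form E N 1 := fun x =>
  ContinuousAlternatingMap.ofSubsingleton ℝ _ ℝ (0 : Fin 1) (S.η x)

theorem φ_ξ (x : N) : S.φ x (S.ξ x) = 0 := by
  have h1 : S.φ x (S.φ x (S.ξ x)) = 0 := by rw [S.φ_φ, S.η_ξ, one_smul, neg_add_cancel]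
  have h2 := S.φ_φ x (S.φ x (S.ξ x))
  rw [h1, map_zero] at h2
  have h3 : S.φ x (S.ξ x) = S.η x (S.φ x (S.ξ x)) • S.ξ x := by
    rw [eq_comm, neg_add_eq_zero] at h2
    exact h2
  have h4 : S.η x (S.φ x (S.ξ x)) • S.φ x (S.ξ x) = 0 := by
    rw [← map_smul, ← h3, h1]
  rcases smul_eq_zero.1 h4 with h | h
  · rw [h3, h, zero_smul]
  · exact h

theorem η_φ (x : N) (X : TangentSpace 𝓘(ℝ, E) x) : S.η x (S.φ x X) = 0 := by
  have h1 := S.φ_φ x (S.φ x X)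
  rw [S.φ_φ x X, map_add, map_smul, S.φ_ξ, smul_zero, add_zero, map_neg] at h1
  have h2 : S.η x (S.φ x X) • S.ξ x = 0 := by
    have := h1.symm
    rwa [add_eq_left] at this
  have h3 := congrArg (S.η x) h2
  rwa [map_smul, S.η_ξ, smul_eq_mul, mul_one, map_zero] at h3

theorem inner_ξ (x : N) (X : TangentSpace 𝓘(ℝ, E) x) : inner ℝ X (S.ξ x) = S.η x X := by
  have h := S.inner_φ_φ x X (S.ξ x)
  rw [S.φ_ξ, inner_zero_right, S.η_ξ, mul_one] at h
  linarith

theorem inner_self_φ (x : N) (X : TangentSpace 𝓘(ℝ, E) x) : inner ℝ X (S.φ x X) = 0 := by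
  have h := S.inner_φ_φ x X (S.φ x X)
  rw [S.η_φ, mul_zero, sub_zero, S.φ_φ, inner_add_right, inner_neg_right, inner_smul_right,
    S.inner_ξ, S.η_φ, mul_zero, add_zero, real_inner_comm] at h
  linarith

/-- The fundamental `2`-form `Φ(X, Y) = g(X, φ Y)`. -/
def fundamentalForm : Form E N 2 := fun x =>
  { toFun := fun v => inner ℝ (v 0) (S.φ x (v 1))
    map_update_add' := by
      intro _ v i a b
      fin_cases i
      · simp [inner_add_left]
      · simp [inner_add_right]
    map_update_smul' := by
      intro _ v i c a
      fin_cases i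
      · simp [inner_smul_left]
      · simp [inner_smul_right]
    cont := (continuous_apply 0).inner ((S.φ x).continuous.comp (continuous_apply 1))
    map_eq_zero_of_eq' := by
      intro v i j hv hij
      have h : v 0 = v 1 := by
        fin_cases i <;> fin_cases j <;> simp_all
      rw [h]
      exact S.inner_self_φ x (v 1) }

@[simp] theorem fundamentalForm_apply (x : N) (v : Fin 2 → TangentSpace 𝓘(ℝ, E) x) :
    S.fundamentalForm x v = inner ℝ (v 0) (S.φ x (v 1)) := rfl

/-- The Nijenhuis tensor of `φ`, evaluated on two vector fields. -/
def nijenhuis (X Y : ∀ x : N, TangentSpace 𝓘(ℝ, E) x) (x : N) : TangentSpace 𝓘(ℝ, E) x :=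
  S.φ x (S.φ x (VectorField.mlieBracket 𝓘(ℝ, E) X Y x))
    + VectorField.mlieBracket 𝓘(ℝ, E) (fun y => S.φ y (X y)) (fun y => S.φ y (Y y)) x
    - S.φ x (VectorField.mlieBracket 𝓘(ℝ, E) (fun y => S.φ y (X y)) Y x)
    - S.φ x (VectorField.mlieBracket 𝓘(ℝ, E) X (fun y => S.φ y (Y y)) x)

/-- Normality. `Form.d` is normalised by `dη(X, Y) = X η(Y) - Y η(X) - η([X, Y])`; in the convention
where the right-hand side is halved, the second summand reads `2 dη(X, Y) ξ`. -/
def IsNormal : Prop :=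
  ∀ X Y : ∀ x : N, TangentSpace 𝓘(ℝ, E) x,
    ContMDiff 𝓘(ℝ, E) 𝓘(ℝ, E).tangent ∞ (fun x => (⟨x, X x⟩ : TangentBundle 𝓘(ℝ, E) N)) →
    ContMDiff 𝓘(ℝ, E) 𝓘(ℝ, E).tangent ∞ (fun x => (⟨x, Y x⟩ : TangentBundle 𝓘(ℝ, E) N)) →
    ∀ x : N, S.nijenhuis X Y x + S.etaForm.d x ![X x, Y x] • S.ξ x = 0

/-- A cosymplectic structure: a normal almost contact metric structure for which `η` and the
fundamental `2`-form are closed. -/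
structure IsCosymplectic : Prop where
  closed_η : S.etaForm ∈ closedForms E N 1
  closed_Φ : S.fundamentalForm ∈ closedForms E N 2
  normal : S.IsNormal

end AlmostContactMetricStructure

end AlmostContact

/-! ### Pointwise slant submanifolds -/

section Slant

variable {E : Type*} [NormedAddCommGroup E] [NormedSpace ℝ E] [FiniteDimensional ℝ E]
  {M : Type*} [TopologicalSpace M] [ChartedSpace E M]
  {E' : Type*} [NormedAddCommGroup E'] [NormedSpace ℝ E']
  {N : Type*} [TopologicalSpace N] [ChartedSpace E' N]

instance instFiniteDimensionalTangentSpace (p : M) :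
    FiniteDimensional ℝ (TangentSpace 𝓘(ℝ, E) p) :=
  inferInstanceAs (FiniteDimensional ℝ E)

variable (E E') in
/-- `f : M → N` is a smooth immersion, that is, `M` is an immersed submanifold of `N`. -/
structure IsSmoothImmersion (f : M → N) : Prop where
  contMDiff : ContMDiff 𝓘(ℝ, E) 𝓘(ℝ, E') ∞ f
  injective_mfderiv : ∀ p, Function.Injective (mfderiv 𝓘(ℝ, E) 𝓘(ℝ, E') f p)

variable (E E') in
/-- The tangent space of the submanifold at `p`, as a subspace of the tangent space of the
ambient manifold at `f p`. -/
def tangentImage (f : M → N) (p : M) : Submodule ℝ (TangentSpace 𝓘(ℝ, E') (f p)) :=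
  LinearMap.range
    (mfderiv 𝓘(ℝ, E) 𝓘(ℝ, E') f p : TangentSpace 𝓘(ℝ, E) p →ₗ[ℝ] TangentSpace 𝓘(ℝ, E') (f p))

instance instFiniteDimensionalTangentImage (f : M → N) (p : M) :
    FiniteDimensional ℝ (tangentImage E E' f p) :=
  inferInstanceAs (FiniteDimensional ℝ (LinearMap.range
    (mfderiv 𝓘(ℝ, E) 𝓘(ℝ, E') f p : TangentSpace 𝓘(ℝ, E) p →ₗ[ℝ] TangentSpace 𝓘(ℝ, E') (f p))))

variable [IsManifold 𝓘(ℝ, E') ∞ N] [RiemannianBundle (fun x : N => TangentSpace 𝓘(ℝ, E') x)]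
  (S : AlmostContactMetricStructure E' N)

variable (E) in
/-- The space `M_p` of vectors tangent to the submanifold at `p` and orthogonal to `ξ`. -/
def slantSpace (f : M → N) (p : M) : Submodule ℝ (TangentSpace 𝓘(ℝ, E') (f p)) :=
  tangentImage E E' f p ⊓ (Submodule.span ℝ {S.ξ (f p)})ᗮ

instance instFiniteDimensionalSlantSpace (f : M → N) (p : M) :
    FiniteDimensional ℝ (slantSpace E S f p) :=
  inferInstanceAs (FiniteDimensional ℝ ↥(tangentImage E E' f p ⊓ _))

variable (E) in
/-- `θ` is a slant function of the submanifold: for each `p` and each nonzero `X ∈ M_p`, the angle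
between `φ X` and the subspace `M_p` (that is, between `φ X` and its orthogonal projection to `M_p`,
the angle being `π / 2` if the projection vanishes) is equal to `θ p`. -/
def IsSlantFunction (f : M → N) (θ : M → ℝ) : Prop :=
  ∀ p : M, ∀ X ∈ slantSpace E S f p, X ≠ 0 →
    InnerProductGeometry.angle (S.φ (f p) X)
      ((slantSpace E S f p).starProjection (S.φ (f p) X)) = θ p

variable (E) in
/-- A proper pointwise slant submanifold: one with a slant function with values in `[0, π / 2)`. -/
def IsProperPointwiseSlant (f : M → N) : Prop :=
  ∃ θ : M → ℝ, IsSlantFunction E S f θ ∧ ∀ p, θ p ∈ Set.Ico 0 (Real.pi / 2)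

variable {f : M → N} (hf : IsSmoothImmersion E E' f)

/-- The operator `T`: for `X` tangent to the submanifold, `T X` is the tangential part of `φ X`. -/
def tangentialPart (p : M) : TangentSpace 𝓘(ℝ, E) p →ₗ[ℝ] TangentSpace 𝓘(ℝ, E) p :=
  (LinearEquiv.ofInjective
      (mfderiv 𝓘(ℝ, E) 𝓘(ℝ, E') f p : TangentSpace 𝓘(ℝ, E) p →ₗ[ℝ] TangentSpace 𝓘(ℝ, E') (f p))
      (hf.injective_mfderiv p)).symm.toLinearMap ∘ₗ
    (tangentImage E E' f p).orthogonalProjectionOnto.toLinearMap ∘ₗ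
    (S.φ (f p)).toLinearMap ∘ₗ (mfderiv 𝓘(ℝ, E) 𝓘(ℝ, E') f p).toLinearMap

theorem mfderiv_tangentialPart (p : M) (X : TangentSpace 𝓘(ℝ, E) p) :
    mfderiv 𝓘(ℝ, E) 𝓘(ℝ, E') f p (tangentialPart S hf p X) =
      (tangentImage E E' f p).starProjection
        (S.φ (f p) (mfderiv 𝓘(ℝ, E) 𝓘(ℝ, E') f p X)) := by
  have h := LinearEquiv.ofInjective_symm_apply (h := hf.injective_mfderiv p)
    (f := (mfderiv 𝓘(ℝ, E) 𝓘(ℝ, E') f p :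
      TangentSpace 𝓘(ℝ, E) p →ₗ[ℝ] TangentSpace 𝓘(ℝ, E') (f p)))
    ((tangentImage E E' f p).orthogonalProjectionOnto
      (S.φ (f p) (mfderiv 𝓘(ℝ, E) 𝓘(ℝ, E') f p X)))
  exact h

theorem inner_tangentialPart (p : M) (X Y : TangentSpace 𝓘(ℝ, E) p) :
    inner ℝ (mfderiv 𝓘(ℝ, E) 𝓘(ℝ, E') f p X)
      (mfderiv 𝓘(ℝ, E) 𝓘(ℝ, E') f p (tangentialPart S hf p Y)) =
    inner ℝ (mfderiv 𝓘(ℝ, E) 𝓘(ℝ, E') f p X)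
      (S.φ (f p) (mfderiv 𝓘(ℝ, E) 𝓘(ℝ, E') f p Y)) := by
  have hX : mfderiv 𝓘(ℝ, E) 𝓘(ℝ, E') f p X ∈ tangentImage E E' f p := ⟨X, rfl⟩
  rw [mfderiv_tangentialPart, ← Submodule.inner_starProjection_left_eq_right,
    Submodule.starProjection_eq_self_iff.2 hX]

/-- The `2`-form `Ω(X, Y) = g(X, T Y)` on the submanifold, where `g` is the induced metric. -/
def slantForm : Form E M 2 := fun p =>
  { toFun := fun v => inner ℝ (mfderiv 𝓘(ℝ, E) 𝓘(ℝ, E') f p (v 0))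
      (mfderiv 𝓘(ℝ, E) 𝓘(ℝ, E') f p (tangentialPart S hf p (v 1)))
    map_update_add' := by
      intro _ v i a b
      fin_cases i
      · simp [inner_add_left]
      · simp [inner_add_right]
    map_update_smul' := by
      intro _ v i c a
      fin_cases i
      · simp [inner_smul_left]
      · simp [inner_smul_right]
    cont := by
      refine Continuous.congr (f := fun v : Fin 2 → TangentSpace 𝓘(ℝ, E) p =>
        inner ℝ (mfderiv 𝓘(ℝ, E) 𝓘(ℝ, E') f p (v 0))
          (S.φ (f p) (mfderiv 𝓘(ℝ, E) 𝓘(ℝ, E') f p (v 1)))) ?_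
        fun v => (inner_tangentialPart S hf p (v 0) (v 1)).symm
      exact ((mfderiv 𝓘(ℝ, E) 𝓘(ℝ, E') f p).continuous.comp (continuous_apply 0)).inner
        ((S.φ (f p)).continuous.comp
          ((mfderiv 𝓘(ℝ, E) 𝓘(ℝ, E') f p).continuous.comp (continuous_apply 1)))
    map_eq_zero_of_eq' := by
      intro v i j hv hij
      have h : v 0 = v 1 := by
        fin_cases i <;> fin_cases j <;> simp_all
      change inner ℝ (mfderiv 𝓘(ℝ, E) 𝓘(ℝ, E') f p (v 0))
        (mfderiv 𝓘(ℝ, E) 𝓘(ℝ, E') f p (tangentialPart S hf p (v 1))) = 0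
      rw [inner_tangentialPart, h]
      exact S.inner_self_φ (f p) _ }

end Slant

end PointwiseSlant

end

open PointwiseSlant

/-! The argument is that of compact cosymplectic manifolds. For tangent vectors, `g(X, TY) = g(X,
φY)`, so `Ω` is the pullback of `Φ` (`slantForm_eq_pullback`), just as the restricted `η` is a
pullback. Pullback commutes with `d` (`Form.d_pullback`), so both forms are closed on `M`.

The slant condition gives nondegeneracy. If `X ≠ 0` is tangent with `η(X) = 0`, the angle between
`φX` and its projection `P` to `M_p` is less than `π / 2`, so `P ≠ 0` and `g(P, φX) = g(P, P) ≠ 0`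
(`slantBilin_nondegenerate`). Hence `ker η` has a symplectic family of `m` pairs
(`exists_symplectic_family`). On `ξ` followed by this family `η ∧ Ω^m` is positive
(`antisym_pairing_pos`, `wedge_wedgePow_ne_zero`).

By Stokes, an exact form of top degree on a nonempty compact manifold has a zero
(`exists_eq_zero_of_mem_exactForms`). If `Ω^j` or `η ∧ Ω^j` were exact for some `j ≤ m`, multiplying
by closed forms would make `η ∧ Ω^m` exact. So none is exact, and these forms occupy every degree
from `0` to `2m + 1`.

Stokes is proved without an orientation: if `dα` has no zero, `|dα|` is a density, and a partition
of unity shows that its integral is both zero and positive. -/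

namespace PointwiseSlant

/-! ### Antisymmetrization of functions of several vectors -/

section Antisymmetrization

open Equiv

variable {V ι κ : Type*} [Fintype ι] [DecidableEq ι] [Fintype κ] [DecidableEq κ]

/-- The antisymmetrization `v ↦ ∑ σ, sign σ * T (v ∘ σ)` of a function of a family of vectors. -/
noncomputable def antisym (T : (ι → V) → ℝ) (v : ι → V) : ℝ :=
  ∑ σ : Perm ι, ((Perm.sign σ : ℤ) : ℝ) * T (v ∘ σ)

theorem sign_mul_sign_cast (σ : Perm ι) : ((Perm.sign σ : ℤ) : ℝ) * ((Perm.sign σ : ℤ) : ℝ) = 1 := by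
  rcases Int.units_eq_one_or (Perm.sign σ) with h | h <;> simp [h]

theorem antisym_const_mul (c : ℝ) (T : (ι → V) → ℝ) (v : ι → V) :
    antisym (fun w => c * T w) v = c * antisym T v := by
  rw [antisym, antisym, Finset.mul_sum]
  exact Finset.sum_congr rfl fun σ _ => by ring

theorem antisym_add (T U : (ι → V) → ℝ) (v : ι → V) :
    antisym (fun w => T w + U w) v = antisym T v + antisym U v := by
  rw [antisym, antisym, antisym, ← Finset.sum_add_distrib]
  exact Finset.sum_congr rfl fun σ _ => by ring

theorem antisym_sum {γ : Type*} (s : Finset γ) (T : γ → (ι → V) → ℝ) (v : ι → V) :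
    antisym (fun w => ∑ i ∈ s, T i w) v = ∑ i ∈ s, antisym (T i) v := by
  simp only [antisym, Finset.mul_sum]
  exact Finset.sum_comm

theorem antisym_comp_perm (τ : Perm ι) (T : (ι → V) → ℝ) (v : ι → V) :
    antisym (fun w => T (w ∘ τ)) v = ((Perm.sign τ : ℤ) : ℝ) * antisym T v := by
  rw [antisym, antisym, Finset.mul_sum]
  refine Fintype.sum_equiv (Equiv.mulRight τ) _ _ fun σ => ?_
  have h := sign_mul_sign_cast τ
  have h2 : v ∘ ⇑(Equiv.mulRight τ σ) = (v ∘ ⇑σ) ∘ ⇑τ := by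
    ext i; simp
  rw [h2]
  simp only [Equiv.coe_mulRight, Perm.sign_mul, Units.val_mul, Int.cast_mul]
  linear_combination (-((Perm.sign σ : ℤ) : ℝ) * T ((v ∘ σ) ∘ τ)) * h

theorem antisym_comp_equiv (e : ι ≃ κ) (T : (ι → V) → ℝ) (v : κ → V) :
    antisym (fun w : κ → V => T (w ∘ e)) v = antisym T (v ∘ e) := by
  rw [antisym, antisym]
  refine (Fintype.sum_equiv e.permCongr _ _ fun σ => ?_).symm
  rw [Perm.sign_permCongr]
  congr 2
  ext i
  simp [Equiv.permCongr_apply]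

/-- Each inner permutation is absorbed by the outer sum, its sign cancelling, so every inner term
contributes equally. Only preservation of sign is needed of `e`, not multiplicativity. -/
theorem antisym_partial {α : Type*} [Fintype α] [DecidableEq α] (e : Perm α → Perm ι)
    (he : ∀ τ, Perm.sign (e τ) = Perm.sign τ) (T : (ι → V) → ℝ) (v : ι → V) :
    antisym (fun w => ∑ τ : Perm α, ((Perm.sign τ : ℤ) : ℝ) * T (w ∘ e τ)) v =
      ((Fintype.card α).factorial : ℝ) * antisym T v := by
  rw [antisym_sum]
  have h : ∀ τ : Perm α, antisym (fun w => ((Perm.sign τ : ℤ) : ℝ) * T (w ∘ e τ)) v = antisym T v := by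
    intro τ
    rw [antisym_const_mul, antisym_comp_perm, he, ← mul_assoc, sign_mul_sign_cast, one_mul]
  rw [Finset.sum_congr rfl fun τ _ => h τ]
  simp [Fintype.card_perm]

theorem antisym_antisym_mul {k l : ℕ} (G : (Fin k → V) → ℝ) (H : (Fin l → V) → ℝ)
    (v : Fin (k + l) → V) :
    antisym (fun w => antisym G (fun i => w (Fin.castAdd l i)) * H (fun i => w (Fin.natAdd k i))) v
      = (k.factorial : ℝ) * antisym (fun w : Fin (k + l) → V =>
        G (fun i => w (Fin.castAdd l i)) * H (fun i => w (Fin.natAdd k i))) v := by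
  have h := antisym_partial (fun τ : Perm (Fin k) => finSumFinEquiv.permCongr (Perm.sumCongr τ 1))
    (fun τ => by rw [Perm.sign_permCongr, Perm.sign_sumCongr, Perm.sign_one, mul_one])
    (fun w : Fin (k + l) → V =>
      G (fun i => w (Fin.castAdd l i)) * H (fun i => w (Fin.natAdd k i))) v
  rw [Fintype.card_fin] at h
  rw [← h]
  congr 1
  funext w
  rw [antisym, Finset.sum_mul]
  refine Finset.sum_congr rfl fun τ _ => ?_
  simp [Function.comp_def, Equiv.permCongr_apply, mul_assoc]

theorem antisym_mul_antisym {k l : ℕ} (G : (Fin k → V) → ℝ) (H : (Fin l → V) → ℝ)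
    (v : Fin (k + l) → V) :
    antisym (fun w => G (fun i => w (Fin.castAdd l i)) * antisym H (fun i => w (Fin.natAdd k i))) v
      = (l.factorial : ℝ) * antisym (fun w : Fin (k + l) → V =>
        G (fun i => w (Fin.castAdd l i)) * H (fun i => w (Fin.natAdd k i))) v := by
  have h := antisym_partial (fun τ : Perm (Fin l) => finSumFinEquiv.permCongr (Perm.sumCongr 1 τ))
    (fun τ => by rw [Perm.sign_permCongr, Perm.sign_sumCongr, Perm.sign_one, one_mul])
    (fun w : Fin (k + l) → V =>
      G (fun i => w (Fin.castAdd l i)) * H (fun i => w (Fin.natAdd k i))) v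
  rw [Fintype.card_fin] at h
  rw [← h]
  congr 1
  funext w
  rw [antisym, Finset.mul_sum]
  refine Finset.sum_congr rfl fun τ _ => ?_
  simp [Function.comp_def, Equiv.permCongr_apply, mul_left_comm]

/-- The inner permutations are those of `Fin (n + 1)` fixing `0`, the slot that will hold the
direction of differentiation. -/
theorem antisym_antisym_succ {n : ℕ} (G : V → (Fin n → V) → ℝ) (v : Fin (n + 1) → V) :
    antisym (fun w => antisym (G (w 0)) (fun i => w i.succ)) v =
      (n.factorial : ℝ) * antisym (fun w : Fin (n + 1) → V => G (w 0) (fun i => w i.succ)) v := by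
  have h := antisym_partial (fun τ : Perm (Fin n) => Perm.decomposeFin.symm (0, τ))
    (fun τ => by rw [Perm.decomposeFin.symm_sign]; simp)
    (fun w : Fin (n + 1) → V => G (w 0) (fun i => w i.succ)) v
  rw [Fintype.card_fin] at h
  rw [← h]
  congr 1

variable [AddCommGroup V] [Module ℝ V]

theorem antisym_alternatingMap (g : V [⋀^ι]→ₗ[ℝ] ℝ) (v : ι → V) :
    antisym g v = ((Fintype.card ι).factorial : ℝ) * g v := by
  have h : ∀ σ : Perm ι, ((Perm.sign σ : ℤ) : ℝ) * g (v ∘ σ) = g v := by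
    intro σ
    rw [g.map_perm, Units.smul_def, zsmul_eq_mul, ← mul_assoc, sign_mul_sign_cast, one_mul]
  rw [antisym, Finset.sum_congr rfl fun σ _ => h σ]
  simp [Fintype.card_perm]

/-- The left side is a signed sum over `n + 1` cycles. Antisymmetrizing it gives `n + 1` times the
antisymmetrization of `f`, but also `(n + 1)!` times itself since it is already alternating. This
puts `extDeriv` and `wedge` in the same language. -/
theorem alternatizeUncurryFin_eq_antisym {n : ℕ} (f : V →ₗ[ℝ] V [⋀^Fin n]→ₗ[ℝ] ℝ)
    (v : Fin (n + 1) → V) :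
    AlternatingMap.alternatizeUncurryFin f v =
      (n.factorial : ℝ)⁻¹ * antisym (fun w : Fin (n + 1) → V => f (w 0) (fun i => w i.succ)) v := by
  have h1 := antisym_alternatingMap (AlternatingMap.alternatizeUncurryFin f) v
  have h2 : antisym (AlternatingMap.alternatizeUncurryFin f) v =
      ((n : ℝ) + 1) * antisym (fun w : Fin (n + 1) → V => f (w 0) (fun i => w i.succ)) v := by
    have h3 : (AlternatingMap.alternatizeUncurryFin f : (Fin (n + 1) → V) → ℝ) = fun w =>
        ∑ i : Fin (n + 1), ((Perm.sign (Fin.cycleRange i).symm : ℤ) : ℝ) *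
          (fun u : Fin (n + 1) → V => f (u 0) (fun i => u i.succ)) (w ∘ (Fin.cycleRange i).symm) := by
      funext w
      rw [AlternatingMap.alternatizeUncurryFin_apply]
      refine Finset.sum_congr rfl fun i _ => ?_
      simp [Fin.sign_cycleRange, Equiv.Perm.sign_symm, Fin.cycleRange_symm_succ]
      rfl
    rw [h3, antisym_sum]
    have h4 : ∀ i : Fin (n + 1), antisym (fun w => ((Perm.sign (Fin.cycleRange i).symm : ℤ) : ℝ) *
        (fun u : Fin (n + 1) → V => f (u 0) (fun i => u i.succ)) (w ∘ (Fin.cycleRange i).symm)) v =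
        antisym (fun w : Fin (n + 1) → V => f (w 0) (fun i => w i.succ)) v := by
      intro i
      rw [antisym_const_mul, antisym_comp_perm (Fin.cycleRange i).symm
        (fun u : Fin (n + 1) → V => f (u 0) (fun i => u i.succ)), ← mul_assoc,
        sign_mul_sign_cast, one_mul]
    rw [Finset.sum_congr rfl fun i _ => h4 i]
    simp
  rw [h2, Fintype.card_fin, Nat.factorial_succ] at h1
  have h5 : ((n : ℝ) + 1) ≠ 0 := by positivity
  have h6 : (n.factorial : ℝ) ≠ 0 := by positivity
  push_cast at h1
  rw [mul_assoc] at h1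
  rw [mul_left_cancel₀ h5 h1, inv_mul_cancel_left₀ h6]

end Antisymmetrization

/-! ### Properties of the wedge product -/

theorem antisym_continuousAlternatingMap {V : Type*} [AddCommGroup V] [Module ℝ V] [TopologicalSpace V]
    {k : ℕ} (α : V [⋀^Fin k]→L[ℝ] ℝ) (v : Fin k → V) :
    antisym α v = (k.factorial : ℝ) * α v := by
  have h := antisym_alternatingMap α.toAlternatingMap v
  rwa [Fintype.card_fin] at h

section WedgeAlgebra

variable {V : Type*} [AddCommGroup V] [Module ℝ V] [TopologicalSpace V]
  [IsTopologicalAddGroup V] [ContinuousConstSMul ℝ V]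

theorem wedge_apply {k l : ℕ} (α : V [⋀^Fin k]→L[ℝ] ℝ) (β : V [⋀^Fin l]→L[ℝ] ℝ)
    (v : Fin (k + l) → V) :
    wedge α β v = ((k.factorial : ℝ) * l.factorial)⁻¹ * antisym (fun w : Fin (k + l) → V =>
      α (fun i => w (Fin.castAdd l i)) * β (fun j => w (Fin.natAdd k j))) v := by
  rw [wedge, ContinuousAlternatingMap.smul_apply,
    ContinuousMultilinearMap.alternatization_apply_apply, antisym, smul_eq_mul, Nat.cast_mul]
  congr 1
  refine Finset.sum_congr rfl fun σ _ => ?_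
  rw [tensor_apply, Units.smul_def, zsmul_eq_mul]

theorem wedge_add_left {k l : ℕ} (α α' : V [⋀^Fin k]→L[ℝ] ℝ) (β : V [⋀^Fin l]→L[ℝ] ℝ) :
    wedge (α + α') β = wedge α β + wedge α' β := by
  ext v
  simp only [ContinuousAlternatingMap.add_apply, wedge_apply, add_mul, antisym_add, mul_add]

theorem wedge_add_right {k l : ℕ} (α : V [⋀^Fin k]→L[ℝ] ℝ) (β β' : V [⋀^Fin l]→L[ℝ] ℝ) :
    wedge α (β + β') = wedge α β + wedge α β' := by
  ext v
  simp only [ContinuousAlternatingMap.add_apply, wedge_apply, antisym_add, mul_add]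

theorem wedge_smul_left {k l : ℕ} (c : ℝ) (α : V [⋀^Fin k]→L[ℝ] ℝ) (β : V [⋀^Fin l]→L[ℝ] ℝ) :
    wedge (c • α) β = c • wedge α β := by
  ext v
  simp only [ContinuousAlternatingMap.smul_apply, wedge_apply, smul_eq_mul, mul_assoc,
    antisym_const_mul]
  ring

theorem wedge_smul_right {k l : ℕ} (c : ℝ) (α : V [⋀^Fin k]→L[ℝ] ℝ) (β : V [⋀^Fin l]→L[ℝ] ℝ) :
    wedge α (c • β) = c • wedge α β := by
  ext v
  simp only [ContinuousAlternatingMap.smul_apply, wedge_apply, smul_eq_mul, mul_left_comm _ c,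
    antisym_const_mul]

theorem wedge_zero_left {k l : ℕ} (β : V [⋀^Fin l]→L[ℝ] ℝ) :
    wedge (0 : V [⋀^Fin k]→L[ℝ] ℝ) β = 0 := by
  have h := wedge_smul_left (0 : ℝ) (0 : V [⋀^Fin k]→L[ℝ] ℝ) β
  rwa [zero_smul, zero_smul] at h

theorem wedge_zero_right {k l : ℕ} (α : V [⋀^Fin k]→L[ℝ] ℝ) :
    wedge α (0 : V [⋀^Fin l]→L[ℝ] ℝ) = 0 := by
  have h := wedge_smul_right (0 : ℝ) α (0 : V [⋀^Fin l]→L[ℝ] ℝ)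
  rwa [zero_smul, zero_smul] at h

/-- Associativity of the wedge product when the last factor is a `2`-form; in this case the two
sides have definitionally equal degrees. -/
theorem wedge_assoc_two {k l : ℕ} (α : V [⋀^Fin k]→L[ℝ] ℝ) (β : V [⋀^Fin l]→L[ℝ] ℝ)
    (τ : V [⋀^Fin 2]→L[ℝ] ℝ) :
    wedge (wedge α β) τ = wedge α (wedge β τ) := by
  ext v
  rw [wedge_apply]
  refine Eq.trans ?_ (wedge_apply α (wedge β τ) v).symm
  simp only [wedge_apply, mul_assoc, antisym_const_mul,
    mul_left_comm _ ((l.factorial : ℝ) * (Nat.factorial 2 : ℝ))⁻¹]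
  rw [antisym_antisym_mul (fun w : Fin (k + l) → V =>
      α (fun i => w (Fin.castAdd l i)) * β (fun j => w (Fin.natAdd k j))) τ,
    antisym_mul_antisym α (fun w : Fin (l + 2) → V =>
      β (fun i => w (Fin.castAdd 2 i)) * τ (fun j => w (Fin.natAdd l j)))]
  have h : antisym (fun w : Fin (k + l + 2) → V =>
      (α (fun i => w (Fin.castAdd 2 (Fin.castAdd l i))) *
        β (fun j => w (Fin.castAdd 2 (Fin.natAdd k j)))) *
        τ (fun j => w (Fin.natAdd (k + l) j))) v =
      antisym (fun w : Fin (k + (l + 2)) → V => α (fun i => w (Fin.castAdd (l + 2) i)) *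
        (β (fun i => w (Fin.natAdd k (Fin.castAdd 2 i))) *
          τ (fun j => w (Fin.natAdd k (Fin.natAdd l j))))) v := by
    congr 1
    funext w
    rw [mul_assoc]
    congr 3
    funext j
    congr 1
    ext
    simp [add_assoc]
  rw [h]
  have h1 : ((k + l).factorial : ℝ) ≠ 0 := by positivity
  have h2 : ((l + 2).factorial : ℝ) ≠ 0 := by positivity
  field_simp

theorem wedge_compContinuousLinearMap {W : Type*} [AddCommGroup W] [Module ℝ W]
    [TopologicalSpace W] [IsTopologicalAddGroup W] [ContinuousConstSMul ℝ W] {k l : ℕ}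
    (α : V [⋀^Fin k]→L[ℝ] ℝ) (β : V [⋀^Fin l]→L[ℝ] ℝ) (A : W →L[ℝ] V) :
    (wedge α β).compContinuousLinearMap A =
      wedge (α.compContinuousLinearMap A) (β.compContinuousLinearMap A) := by
  ext v
  rw [ContinuousAlternatingMap.compContinuousLinearMap_apply, wedge_apply, wedge_apply]
  rfl

end WedgeAlgebra

/-! ### The Leibniz rule on a normed space -/

section Leibniz

variable {E : Type*} [NormedAddCommGroup E] [NormedSpace ℝ E]

theorem continuous_alternatizeUncurryFin_eq_antisym {n : ℕ} (f : E →L[ℝ] E [⋀^Fin n]→L[ℝ] ℝ)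
    (v : Fin (n + 1) → E) :
    ContinuousAlternatingMap.alternatizeUncurryFin f v =
      (n.factorial : ℝ)⁻¹ * antisym (fun w : Fin (n + 1) → E => f (w 0) (fun i => w i.succ)) v := by
  refine Eq.trans ?_ (alternatizeUncurryFin_eq_antisym
    (ContinuousAlternatingMap.toAlternatingMapLinear (R := ℝ) ∘ₗ (f : E →ₗ[ℝ] _)) v)
  rw [ContinuousAlternatingMap.alternatizeUncurryFin_apply,
    AlternatingMap.alternatizeUncurryFin_apply]
  rfl

theorem exists_norm_wedge_le (k l : ℕ) : ∃ C : ℝ, ∀ (α : E [⋀^Fin k]→L[ℝ] ℝ)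
    (β : E [⋀^Fin l]→L[ℝ] ℝ), ‖wedge α β‖ ≤ C * ‖α‖ * ‖β‖ := by
  refine ⟨((k.factorial : ℝ) * l.factorial)⁻¹ * (k + l).factorial, fun α β => ?_⟩
  refine ContinuousAlternatingMap.opNorm_le_bound _ (by positivity) fun v => ?_
  have h : ∀ σ : Equiv.Perm (Fin (k + l)),
      ‖((Equiv.Perm.sign σ : ℤ) : ℝ) * (α (fun i => v (σ (Fin.castAdd l i))) *
        β (fun j => v (σ (Fin.natAdd k j))))‖ ≤ ‖α‖ * ‖β‖ * ∏ i, ‖v i‖ := by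
    intro σ
    have h1 : ‖((Equiv.Perm.sign σ : ℤ) : ℝ)‖ = 1 := by
      rcases Int.units_eq_one_or (Equiv.Perm.sign σ) with h | h <;> simp [h]
    rw [norm_mul, h1, one_mul, norm_mul, ← Equiv.prod_comp σ fun i => ‖v i‖, Fin.prod_univ_add,
      mul_mul_mul_comm]
    exact mul_le_mul (α.le_opNorm _) (β.le_opNorm _) (norm_nonneg _) (by positivity)
  rw [wedge_apply, norm_mul, antisym, Real.norm_of_nonneg (by positivity)]
  refine (mul_le_mul_of_nonneg_left ((norm_sum_le _ _).trans (Finset.sum_le_sum fun σ _ => h σ))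
    (by positivity)).trans (le_of_eq ?_)
  simp only [Finset.sum_const, Finset.card_univ, Fintype.card_perm, Fintype.card_fin, nsmul_eq_mul]
  ring

/-- This supplies both the product rule for derivatives and the smoothness of wedge products. -/
theorem isBoundedBilinearMap_wedge (k l : ℕ) :
    IsBoundedBilinearMap ℝ fun p : E [⋀^Fin k]→L[ℝ] ℝ × E [⋀^Fin l]→L[ℝ] ℝ => wedge p.1 p.2 := by
  obtain ⟨C, hC⟩ := exists_norm_wedge_le (E := E) k l
  exact
    { add_left := wedge_add_left
      smul_left := wedge_smul_left
      add_right := wedge_add_right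
      smul_right := wedge_smul_right
      bound := ⟨max C 1, by positivity, fun α β => (hC α β).trans (by gcongr; exact le_max_left _ _)⟩ }

end Leibniz

section Leibniz

variable {E : Type*} [NormedAddCommGroup E] [NormedSpace ℝ E]

open ContinuousAlternatingMap (alternatizeUncurryFin)

/-- The direction of differentiation already stands in front of the arguments of `A`, so no sign
appears. The cast is needed because `k + l + 1` and `k + 1 + l` are not definitionally equal. -/
theorem alternatizeUncurryFin_wedge_const {k l : ℕ} (A : E →L[ℝ] E [⋀^Fin k]→L[ℝ] ℝ)
    (b : E [⋀^Fin l]→L[ℝ] ℝ) (D : E →L[ℝ] E [⋀^Fin (k + l)]→L[ℝ] ℝ)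
    (hD : ∀ x, D x = wedge (A x) b) (v : Fin (k + l + 1) → E) :
    alternatizeUncurryFin D v =
      wedge (alternatizeUncurryFin A) b (fun i => v (Fin.cast (Nat.add_right_comm k 1 l) i)) := by
  rw [continuous_alternatizeUncurryFin_eq_antisym, wedge_apply]
  simp only [hD, wedge_apply, continuous_alternatizeUncurryFin_eq_antisym, mul_assoc,
    antisym_const_mul]
  rw [antisym_antisym_mul (fun w : Fin (k + 1) → E => A (w 0) fun i => w i.succ) b,
    antisym_antisym_succ fun (x : E) (w : Fin (k + l) → E) =>
      A x (fun i => w (Fin.castAdd l i)) * b (fun j => w (Fin.natAdd k j))]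
  have h := antisym_comp_equiv (finCongr (Nat.add_right_comm k 1 l))
    (fun w : Fin (k + 1 + l) → E => A (w (Fin.castAdd l 0)) (fun i => w (Fin.castAdd l i.succ)) *
      b (fun j => w (Fin.natAdd (k + 1) j))) v
  have h' : antisym (fun w : Fin (k + l + 1) → E =>
      A (w 0) (fun i => w (Fin.castAdd l i).succ) * b (fun j => w (Fin.natAdd k j).succ)) v =
      antisym (fun w : Fin (k + 1 + l) → E =>
        A (w (Fin.castAdd l 0)) (fun i => w (Fin.castAdd l i.succ)) *
        b (fun j => w (Fin.natAdd (k + 1) j))) (v ∘ finCongr (Nat.add_right_comm k 1 l)) := by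
    rw [← h]
    congr 1
    funext w
    congr 2
    funext j
    simp only [Function.comp_apply]
    congr 1
    ext
    simp
    omega
  rw [h']
  have h1 : ((k + 1).factorial : ℝ) ≠ 0 := by positivity
  have h2 : ((k + l).factorial : ℝ) ≠ 0 := by positivity
  change _ = _ * (_ * (_ * antisym _ (v ∘ finCongr (Nat.add_right_comm k 1 l))))
  field_simp

/-- The direction of differentiation has to be moved past the `k` arguments of `a`; this is a cycle
of length `k + 1`, of sign `(-1) ^ k`. -/
theorem alternatizeUncurryFin_const_wedge {k l : ℕ} (a : E [⋀^Fin k]→L[ℝ] ℝ)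
    (B : E →L[ℝ] E [⋀^Fin l]→L[ℝ] ℝ) (D : E →L[ℝ] E [⋀^Fin (k + l)]→L[ℝ] ℝ)
    (hD : ∀ x, D x = wedge a (B x)) :
    alternatizeUncurryFin D = (-1 : ℝ) ^ k • wedge a (alternatizeUncurryFin B) := by
  ext v
  rw [continuous_alternatizeUncurryFin_eq_antisym, ContinuousAlternatingMap.smul_apply]
  refine Eq.trans ?_ (congrArg _ (wedge_apply a (alternatizeUncurryFin B) v).symm)
  simp only [hD, wedge_apply, continuous_alternatizeUncurryFin_eq_antisym,
    antisym_const_mul, mul_left_comm _ (l.factorial : ℝ)⁻¹]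
  rw [antisym_mul_antisym a (fun w : Fin (l + 1) → E => B (w 0) fun i => w i.succ),
    antisym_antisym_succ fun (x : E) (w : Fin (k + l) → E) =>
      a (fun i => w (Fin.castAdd l i)) * B x (fun j => w (Fin.natAdd k j))]
  have h := antisym_comp_perm (Fin.cycleRange (⟨k, by omega⟩ : Fin (k + l + 1)))
    (fun w : Fin (k + l + 1) → E => a (fun i => w (Fin.castAdd (l + 1) i)) *
      B (w (Fin.natAdd k (0 : Fin (l + 1)))) (fun j => w (Fin.natAdd k j.succ))) v
  have h' : antisym (fun w : Fin (k + l + 1) → E =>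
      a (fun i => w (Fin.castAdd l i).succ) * B (w 0) (fun j => w (Fin.natAdd k j).succ)) v =
      (-1 : ℝ) ^ k * antisym (fun w : Fin (k + (l + 1)) → E =>
        a (fun i => w (Fin.castAdd (l + 1) i)) *
        B (w (Fin.natAdd k 0)) (fun j => w (Fin.natAdd k j.succ))) v := by
    rw [Fin.sign_cycleRange] at h
    push_cast at h
    refine Eq.trans ?_ h
    congr 1
    funext w
    have e1 : ∀ i : Fin k, Fin.cycleRange (⟨k, by omega⟩ : Fin (k + l + 1))
        (Fin.castAdd (l + 1) i) = (Fin.castAdd l i).succ := by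
      intro i
      rw [Fin.cycleRange_of_lt (Fin.lt_def.2 i.2)]
      ext
      rw [Fin.val_add_one_of_lt (Fin.lt_def.2 (by simp; omega))]
      rfl
    have e2 : Fin.cycleRange (⟨k, by omega⟩ : Fin (k + l + 1))
        (Fin.natAdd k (0 : Fin (l + 1))) = 0 := Fin.cycleRange_self _
    have e3 : ∀ j : Fin l, Fin.cycleRange (⟨k, by omega⟩ : Fin (k + l + 1))
        (Fin.natAdd k j.succ) = (Fin.natAdd k j).succ := by
      intro j
      rw [Fin.cycleRange_of_gt (Fin.lt_def.2 (by simp))]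
      rfl
    simp only [Function.comp_apply, e1, e2, e3]
  rw [h']
  have h2 : ((k + l).factorial : ℝ) ≠ 0 := by positivity
  have h3 : ((l + 1).factorial : ℝ) ≠ 0 := by positivity
  rw [smul_eq_mul]
  field_simp

/-- The Leibniz rule. -/
theorem extDeriv_wedge {k l : ℕ} {a : E → E [⋀^Fin k]→L[ℝ] ℝ}
    {b : E → E [⋀^Fin l]→L[ℝ] ℝ} {x : E} (ha : DifferentiableAt ℝ a x)
    (hb : DifferentiableAt ℝ b x) (v : Fin (k + l + 1) → E) :
    extDeriv (fun y => wedge (a y) (b y)) x v =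
      wedge (extDeriv a x) (b x) (fun i => v (Fin.cast (Nat.add_right_comm k 1 l) i)) +
      (-1 : ℝ) ^ k * wedge (a x) (extDeriv b x) v := by
  have hW := isBoundedBilinearMap_wedge (E := E) k l
  have h := (hW.hasFDerivAt (a x, b x)).comp x (ha.hasFDerivAt.prodMk hb.hasFDerivAt)
  have h1 := alternatizeUncurryFin_wedge_const (fderiv ℝ a x) (b x)
    ((hW.deriv (a x, b x)).comp ((fderiv ℝ a x).prod 0)) (fun y => by
      simp [wedge_zero_right]) v
  have h2 := alternatizeUncurryFin_const_wedge (a x) (fderiv ℝ b x)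
    ((hW.deriv (a x, b x)).comp ((0 : E →L[ℝ] E [⋀^Fin k]→L[ℝ] ℝ).prod (fderiv ℝ b x))) (fun y => by
      simp [wedge_zero_left])
  -- The derivative of the product splits into a part where only `a` varies and a part where only
  -- `b` varies.
  have h3 : (hW.deriv (a x, b x)).comp ((fderiv ℝ a x).prod (fderiv ℝ b x)) =
      (hW.deriv (a x, b x)).comp ((fderiv ℝ a x).prod 0) +
      (hW.deriv (a x, b x)).comp ((0 : E →L[ℝ] E [⋀^Fin k]→L[ℝ] ℝ).prod (fderiv ℝ b x)) := by
    rw [← ContinuousLinearMap.comp_add]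
    congr 1
    ext1 y
    simp
  have h4 : fderiv ℝ (fun y => wedge (a y) (b y)) x = _ := h.fderiv
  rw [extDeriv, h4, h3, ContinuousAlternatingMap.alternatizeUncurryFin_add,
    ContinuousAlternatingMap.add_apply, h1, h2]
  rfl

end Leibniz

/-! ### Nonvanishing of `η ∧ Ω ^ m` -/

section Nonvanishing

open Equiv

/-- A permutation contributes only if it fixes `none` and carries pairs to pairs. It is then a
permutation of the pairs followed or preceded by flips inside them, and its sign equals the product
of its `Ω` values, so no term is negative. The identity contributes `1`. -/
theorem antisym_pairing_pos {V : Type*} {m : ℕ} {η : V → ℝ} {Ω : V → V → ℝ}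
    {b : Option (Fin m × Bool) → V} (h0 : η (b none) = 1) (h1 : ∀ p, η (b (some p)) = 0)
    (hΩ : ∀ i j s t, Ω (b (some (i, s))) (b (some (j, t))) =
      if i = j ∧ t = !s then (if s then -1 else 1) else 0) :
    0 < antisym (fun w : Option (Fin m × Bool) → V =>
      η (w none) * ∏ i, Ω (w (some (i, false))) (w (some (i, true)))) b := by
  refine Finset.sum_pos' (fun σ _ => ?_) ⟨1, Finset.mem_univ _, by simp [h0, hΩ]⟩
  simp only [Function.comp_apply]
  by_cases hσ : σ none = none
  swap
  · obtain ⟨p, hp⟩ := Option.ne_none_iff_exists'.1 hσ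
    rw [hp, h1]
    simp
  have hsome : ∀ q, ∃ p, σ (some q) = some p := fun q =>
    Option.ne_none_iff_exists'.1 fun h => by
      have := σ.injective (h.trans hσ.symm)
      simp at this
  by_cases hpair : ∀ i, ∃ (j : Fin m) (s : Bool),
      σ (some (i, false)) = some (j, s) ∧ σ (some (i, true)) = some (j, !s)
  swap
  · obtain ⟨i, hi⟩ := not_forall.1 hpair
    obtain ⟨⟨j, s⟩, hj⟩ := hsome (i, false)
    obtain ⟨⟨j', s'⟩, hj'⟩ := hsome (i, true)
    have hz : Ω (b (σ (some (i, false)))) (b (σ (some (i, true)))) = 0 := by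
      rw [hj, hj', hΩ, if_neg]
      rintro ⟨rfl, rfl⟩
      exact hi ⟨j, s, hj, hj'⟩
    rw [Finset.prod_eq_zero (Finset.mem_univ i) hz]
    simp
  choose q s hf ht using hpair
  -- If two pairs had the same image pair, then either their first members collide (equal flips), or
  -- the second member of one collides with the first member of the other (opposite flips).
  have hπ : Function.Injective q := by
    intro i i' h
    by_cases hs : s i = s i'
    · have := σ.injective ((hf i).trans ((by rw [h, hs] : _ = _).trans (hf i').symm))
      simpa using this
    · have hs' : s i' = !s i := by cases hi : s i <;> cases hi' : s i' <;> simp_all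
      have := σ.injective ((ht i).trans ((by rw [h, hs'] : _ = _).trans (hf i').symm))
      simp at this
  let P : Perm (Fin m) := Equiv.ofBijective q (Finite.injective_iff_bijective.1 hπ)
  let g : Fin m → Perm Bool := fun i => if s i then swap false true else 1
  have hσ' : σ = optionCongr ((prodCongrRight g).trans (prodCongrLeft fun _ : Bool => P)) := by
    ext1 x
    rcases x with _ | ⟨i, t⟩
    · simpa using hσ
    · cases t
      · rw [hf]
        cases hi : s i <;> simp [P, g, hi]
      · rw [ht]
        cases hi : s i <;> simp [P, g, hi]
  -- `P` acts on both members of the pairs, so its sign enters squared and only the flips count.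
  have hsign : ((Perm.sign σ : ℤ) : ℝ) = ∏ i, (if s i then (-1 : ℝ) else 1) := by
    have e1 : Perm.sign ((prodCongrRight g).trans (prodCongrLeft fun _ : Bool => P)) =
        ∏ i, Perm.sign (g i) := by
      rw [Perm.sign_trans, Perm.sign_prodCongrLeft, Perm.sign_prodCongrRight]
      simp
    rw [hσ', optionCongr_sign, e1]
    push_cast
    refine Finset.prod_congr rfl fun i _ => ?_
    cases hi : s i <;> simp [g, hi]
  have hprod : ∏ i, Ω (b (σ (some (i, false)))) (b (σ (some (i, true)))) =
      ∏ i, (if s i then (-1 : ℝ) else 1) :=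
    Finset.prod_congr rfl fun i _ => by rw [hf, ht, hΩ, if_pos ⟨rfl, rfl⟩]
  rw [hprod, hsign, hσ, h0, one_mul]
  exact mul_self_nonneg _

variable {V : Type*} [AddCommGroup V] [Module ℝ V] [TopologicalSpace V]
  [IsTopologicalAddGroup V] [ContinuousConstSMul ℝ V]

/-- The recursion halves the constant at each step, so it is `2⁻ʲ`; only its positivity matters. -/
theorem exists_wedgePow_two_eq (τ : V [⋀^Fin 2]→L[ℝ] ℝ) (j : ℕ) :
    ∃ c : ℝ, 0 < c ∧ ∀ v : Fin (2 * j) → V, wedgePow τ j v =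
      c * antisym (fun w : Fin (2 * j) → V =>
        ∏ i : Fin j, τ ![w ⟨2 * i, by omega⟩, w ⟨2 * i + 1, by omega⟩]) v := by
  induction j with
  | zero =>
    refine ⟨1, one_pos, fun v => ?_⟩
    simp [antisym, wedgePow]
  | succ j ih =>
    obtain ⟨c, hc, h⟩ := ih
    refine ⟨(((2 * j).factorial : ℝ) * Nat.factorial 2)⁻¹ * (c * (2 * j).factorial),
      by positivity, fun v => ?_⟩
    refine (wedge_apply (wedgePow τ j) τ v).trans ?_
    simp only [h, mul_assoc, antisym_const_mul]
    rw [antisym_antisym_mul (fun w : Fin (2 * j) → V =>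
        ∏ i : Fin j, τ ![w ⟨2 * i, by omega⟩, w ⟨2 * i + 1, by omega⟩]) τ]
    congr 4
    funext w
    rw [Fin.prod_univ_castSucc]
    congr 2
    funext i
    fin_cases i <;> rfl

theorem wedge_wedgePow_ne_zero {m : ℕ} (η : V [⋀^Fin 1]→L[ℝ] ℝ) (Ω : V [⋀^Fin 2]→L[ℝ] ℝ)
    {b : Option (Fin m × Bool) → V} (h0 : η (fun _ => b none) = 1)
    (h1 : ∀ p, η (fun _ => b (some p)) = 0)
    (hΩ : ∀ i j s t, Ω ![b (some (i, s)), b (some (j, t))] =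
      if i = j ∧ t = !s then (if s then -1 else 1) else 0) :
    wedge η (wedgePow Ω m) ≠ 0 := by
  obtain ⟨c, hc, h⟩ := exists_wedgePow_two_eq Ω m
  -- The argument of `η` goes to position `0` and pair `i` to positions `1 + 2i` and `2 + 2i`, the
  -- layout of the wedge power shifted by one.
  let e' : Option (Fin m × Bool) → Fin (1 + 2 * m) := fun x => match x with
    | none => ⟨0, by omega⟩
    | some (i, s) => ⟨1 + 2 * i + (if s then 1 else 0), by split <;> omega⟩
  have he' : Function.Bijective e' := by
    refine (Fintype.bijective_iff_injective_and_card e').2 ⟨?_, ?_⟩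
    · rintro (_ | ⟨i, s⟩) (_ | ⟨j, t⟩) hij
      · rfl
      · simp [e'] at hij
      · simp [e'] at hij
      · simp only [e', Fin.mk.injEq] at hij
        have : i.1 = j.1 ∧ s = t := by
          cases s <;> cases t <;> simp at hij ⊢ <;> omega
        rw [Fin.ext this.1, this.2]
    · simp; ring
  let e := Equiv.ofBijective e' he'
  intro hz
  have hz' := DFunLike.congr_fun hz (b ∘ e.symm)
  rw [wedge_apply] at hz'
  simp only [h, mul_left_comm _ c, antisym_const_mul] at hz'
  rw [antisym_mul_antisym η (fun w : Fin (2 * m) → V =>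
        ∏ i : Fin m, Ω ![w ⟨2 * i, by omega⟩, w ⟨2 * i + 1, by omega⟩])] at hz'
  have hT := antisym_comp_equiv e (fun w : Option (Fin m × Bool) → V =>
      η (fun _ => w none) * ∏ i, Ω ![w (some (i, false)), w (some (i, true))]) (b ∘ e.symm)
  have hb : (b ∘ e.symm) ∘ e = b := by ext; simp
  rw [hb] at hT
  have hpos := antisym_pairing_pos (η := fun x => η fun _ => x) (Ω := fun x y => Ω ![x, y]) h0 h1 hΩ
  rw [← hT] at hpos
  have hfun : (fun w : Fin (1 + 2 * m) → V => (fun w : Option (Fin m × Bool) → V =>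
      η (fun _ => w none) * ∏ i, Ω ![w (some (i, false)), w (some (i, true))]) (w ∘ e)) =
      fun w => η (fun i => w (Fin.castAdd (2 * m) i)) *
        ∏ i : Fin m, Ω ![w (Fin.natAdd 1 ⟨2 * i, by omega⟩),
          w (Fin.natAdd 1 ⟨2 * i + 1, by omega⟩)] := by
    funext w
    have e1 : ∀ i : Fin 1, e none = Fin.castAdd (2 * m) i := fun i => by
      ext; simp [e, e']
    have e2 : ∀ i : Fin m, e (some (i, false)) = Fin.natAdd 1 ⟨2 * i, by omega⟩ := fun i => by
      ext; simp [e, e']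
    have e3 : ∀ i : Fin m, e (some (i, true)) = Fin.natAdd 1 ⟨2 * i + 1, by omega⟩ := fun i => by
      ext; simp [e, e']; ring
    simp only [Function.comp_apply, e2, e3]
    congr 2
    funext i
    rw [e1 i]
  rw [hfun] at hpos
  refine (ne_of_gt ?_) hz'
  exact mul_pos hc (mul_pos (by positivity) (mul_pos (by positivity) hpos))

/-- A nondegenerate alternating form on a space of dimension at least `2 m` admits a symplectic
family of `m` pairs. -/
theorem exists_symplectic_family {W : Type*} [AddCommGroup W] [Module ℝ W]
    (B : W →ₗ[ℝ] W →ₗ[ℝ] ℝ) (hB : ∀ x, B x x = 0) (m : ℕ) (U : Submodule ℝ W)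
    [FiniteDimensional ℝ U] (hU : 2 * m ≤ Module.finrank ℝ U)
    (hnd : ∀ x ∈ U, x ≠ 0 → ∃ y ∈ U, B x y ≠ 0) :
    ∃ b : Fin m × Bool → W, (∀ p, b p ∈ U) ∧ ∀ i j s t, B (b (i, s)) (b (j, t)) =
      if i = j ∧ t = !s then (if s then -1 else 1) else 0 := by
  have hanti : ∀ x y, B x y = - B y x := fun x y => by
    have := hB (x + y)
    simp only [map_add, LinearMap.add_apply, hB] at this
    linarith
  induction m generalizing U with
  | zero => exact ⟨fun p => p.1.elim0, fun p => p.1.elim0, fun i => i.elim0⟩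
  | succ m ih =>
    have : Nontrivial U := Module.nontrivial_of_finrank_pos (R := ℝ) (by omega)
    obtain ⟨⟨e, he⟩, he0⟩ := exists_ne (0 : U)
    obtain ⟨f', hf', hef'⟩ := hnd e he fun h => he0 (Subtype.ext h)
    obtain ⟨f, hf, hef⟩ : ∃ f ∈ U, B e f = 1 :=
      ⟨(B e f')⁻¹ • f', U.smul_mem _ hf', by rw [map_smul, smul_eq_mul, inv_mul_cancel₀ hef']⟩
    have hfe : B f e = -1 := by rw [hanti, hef]
    let L : U →ₗ[ℝ] ℝ × ℝ := ((B e).comp U.subtype).prod ((B f).comp U.subtype)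
    -- The `B`-orthogonal of the hyperbolic pair `e`, `f` inside `U`, of codimension at most `2`.
    let U' : Submodule ℝ W := (LinearMap.ker L).map U.subtype
    have hmem : ∀ x, x ∈ U' ↔ x ∈ U ∧ B e x = 0 ∧ B f x = 0 := by
      intro x
      constructor
      · rintro ⟨⟨y, hy⟩, hy', rfl⟩
        exact ⟨hy, congrArg Prod.fst hy', congrArg Prod.snd hy'⟩
      · rintro ⟨h1, h2, h3⟩
        exact ⟨⟨x, h1⟩, Prod.ext h2 h3, rfl⟩
    have hrank : 2 * m ≤ Module.finrank ℝ U' := by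
      have e1 : Module.finrank ℝ U' = Module.finrank ℝ (LinearMap.ker L) :=
        (Submodule.equivMapOfInjective _ U.subtype_injective _).symm.finrank_eq
      have e2 := LinearMap.finrank_range_add_finrank_ker L
      have e3 := Submodule.finrank_le (LinearMap.range L)
      simp at e3
      omega
    obtain ⟨b, hbU, hb⟩ := ih U' hrank fun x hx hx0 => by
      obtain ⟨h1, h2, h3⟩ := (hmem x).1 hx
      obtain ⟨y, hy, hxy⟩ := hnd x h1 hx0
      -- The projection of `y` to `U'` along `e` and `f`; it pairs with `x` as `y` does, since `x`
      -- is orthogonal to both.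
      refine ⟨y - B e y • f + B f y • e, (hmem _).2 ⟨U.add_mem (U.sub_mem hy (U.smul_mem _ hf))
        (U.smul_mem _ he), ?_, ?_⟩, ?_⟩
      · simp [hef, hB]
      · simp [hfe, hB]
      · simp [hanti x e, hanti x f, h2, h3, hxy]
    refine ⟨fun p => Fin.cases (if p.2 then f else e) (fun i => b (i, p.2)) p.1, ?_, ?_⟩
    · rintro ⟨i, s⟩
      induction i using Fin.cases with
      | zero => cases s <;> simp [he, hf]
      | succ i => exact ((hmem _).1 (hbU (i, s))).1
    · intro i j s t
      have h2 := fun p => ((hmem _).1 (hbU p)).2.1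
      have h3 := fun p => ((hmem _).1 (hbU p)).2.2
      induction i using Fin.cases with
      | zero =>
        induction j using Fin.cases with
        | zero => cases s <;> cases t <;> simp [hef, hfe, hB]
        | succ j => cases s <;> simp [h2, h3, (Fin.succ_ne_zero j).symm]
      | succ i =>
        induction j using Fin.cases with
        | zero => cases t <;> simp [hanti _ e, hanti _ f, h2, h3, Fin.succ_ne_zero]
        | succ j => simp [hb, Fin.succ_inj]

end Nonvanishing

/-! ### Pullback, exterior derivative and wedge product of forms -/

section Smoothness

variable {E : Type*} [NormedAddCommGroup E] [NormedSpace ℝ E]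
  {E' : Type*} [NormedAddCommGroup E'] [NormedSpace ℝ E']

theorem isBoundedLinearMap_alternatization (k : ℕ) :
    IsBoundedLinearMap ℝ (ContinuousMultilinearMap.alternatization :
      ContinuousMultilinearMap ℝ (fun _ : Fin k => E) ℝ → E [⋀^Fin k]→L[ℝ] ℝ) := by
  refine ⟨⟨map_add _, fun c f => ?_⟩, (k.factorial : ℝ), by positivity, fun f => ?_⟩
  · ext v
    simp [ContinuousMultilinearMap.alternatization_apply_apply, Finset.mul_sum, Units.smul_def,
      mul_left_comm]
  · refine ContinuousAlternatingMap.opNorm_le_bound _ (by positivity) fun v => ?_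
    have h : ∀ σ : Equiv.Perm (Fin k),
        ‖Equiv.Perm.sign σ • f (v ∘ σ)‖ ≤ ‖f‖ * ∏ i, ‖v i‖ := by
      intro σ
      have h1 : ‖Equiv.Perm.sign σ • f (v ∘ σ)‖ = ‖f (v ∘ σ)‖ := by
        rcases Int.units_eq_one_or (Equiv.Perm.sign σ) with h | h <;> simp [h]
      rw [h1, ← Equiv.prod_comp σ fun i => ‖v i‖]
      exact f.le_opNorm _
    rw [ContinuousMultilinearMap.alternatization_apply_apply]
    refine ((norm_sum_le _ _).trans (Finset.sum_le_sum fun σ _ => h σ)).trans (le_of_eq ?_)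
    simp only [Finset.sum_const, Finset.card_univ, Fintype.card_perm, Fintype.card_fin,
      nsmul_eq_mul]
    ring

/-- Composition of multilinear maps is analytic in both arguments. The alternating version is
recovered by alternatization, a bounded linear map which multiplies alternating maps by `k!`. -/
theorem _root_.ContDiffAt.continuousAlternatingMap_compContinuousLinearMap {k : ℕ} {G : Type*}
    [NormedAddCommGroup G] [NormedSpace ℝ G] {f : G → E' [⋀^Fin k]→L[ℝ] ℝ} {g : G → E →L[ℝ] E'}
    {n : WithTop ℕ∞} {x : G} (hf : ContDiffAt ℝ n f x) (hg : ContDiffAt ℝ n g x) :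
    ContDiffAt ℝ n (fun y => (f y).compContinuousLinearMap (g y)) x := by
  have h1 : ContDiffAt ℝ n (fun y => (f y).toContinuousMultilinearMap) x :=
    (ContinuousAlternatingMap.toContinuousMultilinearMapCLM (𝕜 := ℝ) (E := E') (F := ℝ)
      (ι := Fin k) ℝ).contDiff.contDiffAt.comp x hf
  have h2 : ContDiffAt ℝ n (fun y => (f y).toContinuousMultilinearMap.compContinuousLinearMap
      fun _ => g y) x :=
    ContDiffAt.comp x (g := fun p : (Fin k → E →L[ℝ] E') ×
        ContinuousMultilinearMap ℝ (fun _ : Fin k => E') ℝ => p.2.compContinuousLinearMap p.1)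
      (f := fun y => (fun _ => g y, (f y).toContinuousMultilinearMap))
      ContinuousMultilinearMap.analyticAt_uncurry_compContinuousLinearMap.contDiffAt
      ((contDiffAt_pi.2 fun _ => hg).prodMk h1)
  have h3 := ((isBoundedLinearMap_alternatization (E := E) k).contDiff.contDiffAt.comp x h2).const_smul
    (k.factorial : ℝ)⁻¹
  refine h3.congr_of_eventuallyEq (Filter.Eventually.of_forall fun y => ?_)
  ext v
  have h4 : (k.factorial : ℝ) ≠ 0 := by positivity
  have h5 := antisym_continuousAlternatingMap ((f y).compContinuousLinearMap (g y)) v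
  simp only [Function.comp_apply, ContinuousAlternatingMap.smul_apply, smul_eq_mul,
    ContinuousMultilinearMap.alternatization_apply_apply, Units.smul_def, zsmul_eq_mul]
  rw [eq_inv_mul_iff_mul_eq₀ h4, ← h5]
  rfl

end Smoothness

section Forms

variable {E : Type*} [NormedAddCommGroup E] [NormedSpace ℝ E]
  {M : Type*} [TopologicalSpace M] [ChartedSpace E M]
  {E' : Type*} [NormedAddCommGroup E'] [NormedSpace ℝ E']
  {N : Type*} [TopologicalSpace N] [ChartedSpace E' N]

/-- All tangent spaces unfold to `E`, so values at propositionally equal points are compared without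
transport. -/
theorem Form.apply_congr {k : ℕ} (τ : Form E M k) {p q : M} (h : p = q)
    (v : Fin k → E) : (τ p : E [⋀^Fin k]→L[ℝ] ℝ) v = (τ q : E [⋀^Fin k]→L[ℝ] ℝ) v := by
  subst h
  rfl

theorem Form.pullback_id {k : ℕ} (τ : Form E M k) : (τ.pullback id : Form E M k) = τ := by
  funext x
  rw [Form.pullback, mfderiv_id]
  rfl

theorem differentiableAt_inChart_of_mem {k : ℕ} {τ : Form E M k} (h : τ ∈ smoothForms E M k)
    {x : M} {y : E} (hy : y ∈ (extChartAt 𝓘(ℝ, E) x).target) :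
    DifferentiableAt ℝ (τ.inChart x) y :=
  ((h x).contDiffAt ((isOpen_extChartAt_target x).mem_nhds hy)).differentiableAt (by simp)

theorem eventually_mem_target_source {f : M → N} (hf : ContMDiff 𝓘(ℝ, E) 𝓘(ℝ, E') ∞ f) {x : M}
    {z : N} {y : E} (hy : y ∈ (extChartAt 𝓘(ℝ, E) x).target)
    (hfy : f ((extChartAt 𝓘(ℝ, E) x).symm y) ∈ (extChartAt 𝓘(ℝ, E') z).source) :
    ∀ᶠ w in 𝓝 y, w ∈ (extChartAt 𝓘(ℝ, E) x).target ∧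
      f ((extChartAt 𝓘(ℝ, E) x).symm w) ∈ (extChartAt 𝓘(ℝ, E') z).source := by
  have h1 := (isOpen_extChartAt_target (I := 𝓘(ℝ, E)) x).mem_nhds hy
  have h2 : ContinuousAt (f ∘ (extChartAt 𝓘(ℝ, E) x).symm) y :=
    hf.continuous.continuousAt.comp
      (((continuousOn_extChartAt_symm x).continuousAt h1))
  exact (Filter.eventually_of_mem h1 fun w hw => hw).and
    (h2.eventually_mem ((isOpen_extChartAt_source z).mem_nhds hfy))

variable [IsManifold 𝓘(ℝ, E) ∞ M] [IsManifold 𝓘(ℝ, E') ∞ N]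

theorem mdifferentiableAt_extChartAt_symm {x : M} {y : E}
    (hy : y ∈ (extChartAt 𝓘(ℝ, E) x).target) :
    MDifferentiableAt 𝓘(ℝ, E) 𝓘(ℝ, E) (extChartAt 𝓘(ℝ, E) x).symm y :=
  (((contMDiffOn_extChartAt_symm (n := ∞) x).contMDiffAt
    ((isOpen_extChartAt_target x).mem_nhds hy))).mdifferentiableAt (by simp)

theorem mdifferentiableAt_extChartAt' {x z : M} (hz : z ∈ (extChartAt 𝓘(ℝ, E) x).source) :
    MDifferentiableAt 𝓘(ℝ, E) 𝓘(ℝ, E) (extChartAt 𝓘(ℝ, E) x) z := by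
  rw [extChartAt_source] at hz
  exact (contMDiffAt_extChartAt' (n := ∞) hz).mdifferentiableAt (by simp)

variable (E E') in
/-- The expression of a map between manifolds in the charts around `x` and `z`. -/
noncomputable def chartExpr (f : M → N) (x : M) (z : N) : E → E' :=
  extChartAt 𝓘(ℝ, E') z ∘ f ∘ (extChartAt 𝓘(ℝ, E) x).symm

theorem contDiffAt_chartExpr {f : M → N} (hf : ContMDiff 𝓘(ℝ, E) 𝓘(ℝ, E') ∞ f) {x : M} {z : N}
    {y : E} (hy : y ∈ (extChartAt 𝓘(ℝ, E) x).target)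
    (hfy : f ((extChartAt 𝓘(ℝ, E) x).symm y) ∈ (extChartAt 𝓘(ℝ, E') z).source) :
    ContDiffAt ℝ ∞ (chartExpr E E' f x z) y := by
  rw [← contMDiffAt_iff_contDiffAt]
  rw [extChartAt_source] at hfy
  have h1 := (contMDiffOn_extChartAt_symm (I := 𝓘(ℝ, E)) (n := ∞) x).contMDiffAt
    ((isOpen_extChartAt_target x).mem_nhds hy)
  have h2 := (hf ((extChartAt 𝓘(ℝ, E) x).symm y)).comp y h1
  exact (contMDiffAt_extChartAt' (I := 𝓘(ℝ, E')) (n := ∞) hfy).comp y h2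

/-- The chain rule, since the inverse chart at `z` undoes the chart at `z` near the point
considered. It reduces pullback of forms on manifolds to pullback on vector spaces. -/
theorem mfderiv_symm_chartExpr {f : M → N} (hf : ContMDiff 𝓘(ℝ, E) 𝓘(ℝ, E') ∞ f) {x : M}
    {z : N} {y : E} (hy : y ∈ (extChartAt 𝓘(ℝ, E) x).target)
    (hfy : f ((extChartAt 𝓘(ℝ, E) x).symm y) ∈ (extChartAt 𝓘(ℝ, E') z).source) (v : E) :
    (mfderiv 𝓘(ℝ, E') 𝓘(ℝ, E') (extChartAt 𝓘(ℝ, E') z).symm (chartExpr E E' f x z y) :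
        E' →L[ℝ] E') (fderiv ℝ (chartExpr E E' f x z) y v) =
      (mfderiv 𝓘(ℝ, E) 𝓘(ℝ, E') f ((extChartAt 𝓘(ℝ, E) x).symm y) : E →L[ℝ] E')
        ((mfderiv 𝓘(ℝ, E) 𝓘(ℝ, E) (extChartAt 𝓘(ℝ, E) x).symm y : E →L[ℝ] E) v) := by
  have h1 : (extChartAt 𝓘(ℝ, E') z).symm ∘ chartExpr E E' f x z =ᶠ[𝓝 y]
      f ∘ (extChartAt 𝓘(ℝ, E) x).symm := by
    filter_upwards [eventually_mem_target_source hf hy hfy] with w hw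
    exact (extChartAt 𝓘(ℝ, E') z).left_inv hw.2
  have h2 := h1.mfderiv_eq (I := 𝓘(ℝ, E)) (I' := 𝓘(ℝ, E'))
  rw [mfderiv_comp y (hf.mdifferentiable (by simp) _) (mdifferentiableAt_extChartAt_symm hy),
    mfderiv_comp y (mdifferentiableAt_extChartAt_symm
      ((extChartAt 𝓘(ℝ, E') z).map_source hfy))
      ((contDiffAt_chartExpr hf hy hfy).differentiableAt (by simp)).mdifferentiableAt,
    mfderiv_eq_fderiv] at h2
  exact DFunLike.congr_fun h2 v

theorem Form.inChart_pullback {k : ℕ} (τ : Form E' N k) {f : M → N}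
    (hf : ContMDiff 𝓘(ℝ, E) 𝓘(ℝ, E') ∞ f) {x : M}
    {z : N} {y : E} (hy : y ∈ (extChartAt 𝓘(ℝ, E) x).target)
    (hfy : f ((extChartAt 𝓘(ℝ, E) x).symm y) ∈ (extChartAt 𝓘(ℝ, E') z).source) :
    (τ.pullback f : Form E M k).inChart x y =
      (τ.inChart z (chartExpr E E' f x z y)).compContinuousLinearMap
        (fderiv ℝ (chartExpr E E' f x z) y) := by
  ext v
  have h : (extChartAt 𝓘(ℝ, E') z).symm (chartExpr E E' f x z y) =
      f ((extChartAt 𝓘(ℝ, E) x).symm y) := (extChartAt 𝓘(ℝ, E') z).left_inv hfy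
  refine Eq.trans ?_ (τ.apply_congr h _).symm
  exact congrArg (τ (f ((extChartAt 𝓘(ℝ, E) x).symm y)) : E' [⋀^Fin k]→L[ℝ] ℝ)
    (funext fun i => (mfderiv_symm_chartExpr hf hy hfy (v i)).symm)

theorem Form.inChart_eq {k : ℕ} (τ : Form E M k) {x z : M} {y : E}
    (hy : y ∈ (extChartAt 𝓘(ℝ, E) x).target)
    (hyz : (extChartAt 𝓘(ℝ, E) x).symm y ∈ (extChartAt 𝓘(ℝ, E) z).source) :
    τ.inChart x y = (τ.inChart z (chartExpr E E (id : M → M) x z y)).compContinuousLinearMap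
        (fderiv ℝ (chartExpr E E (id : M → M) x z) y) := by
  have h := τ.inChart_pullback (f := (id : M → M)) contMDiff_id hy hyz
  rwa [τ.pullback_id] at h

theorem extDeriv_inChart_pullback {k : ℕ} {τ : Form E' N k} (hτ : τ ∈ smoothForms E' N k)
    {f : M → N} (hf : ContMDiff 𝓘(ℝ, E) 𝓘(ℝ, E') ∞ f) {x : M}
    {z : N} {y : E} (hy : y ∈ (extChartAt 𝓘(ℝ, E) x).target)
    (hfy : f ((extChartAt 𝓘(ℝ, E) x).symm y) ∈ (extChartAt 𝓘(ℝ, E') z).source) :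
    extDeriv ((τ.pullback f : Form E M k).inChart x) y =
      (extDeriv (τ.inChart z) (chartExpr E E' f x z y)).compContinuousLinearMap
        (fderiv ℝ (chartExpr E E' f x z) y) := by
  have h : (τ.pullback f : Form E M k).inChart x =ᶠ[𝓝 y] fun w =>
      (τ.inChart z (chartExpr E E' f x z w)).compContinuousLinearMap
        (fderiv ℝ (chartExpr E E' f x z) w) := by
    filter_upwards [eventually_mem_target_source hf hy hfy] with w hw
    exact τ.inChart_pullback hf hw.1 hw.2
  rw [h.extDeriv_eq]
  exact extDeriv_pullback (r := ∞)
    (differentiableAt_inChart_of_mem hτ ((extChartAt 𝓘(ℝ, E') z).map_source hfy))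
    (contDiffAt_chartExpr hf hy hfy) (by simp only [minSmoothness_of_isRCLikeNormedField]; exact ENat.LEInfty.out)

/-- The exterior derivative may be computed in any chart. -/
theorem Form.inChart_d {k : ℕ} {τ : Form E M k} (hτ : τ ∈ smoothForms E M k) {x : M} {y : E}
    (hy : y ∈ (extChartAt 𝓘(ℝ, E) x).target) :
    τ.d.inChart x y = extDeriv (τ.inChart x) y := by
  -- Pull back by the identity and take for `z` the point itself, because `Form.d` is defined
  -- through the chart centred there.
  have h := extDeriv_inChart_pullback hτ (f := (id : M → M)) contMDiff_id (x := x)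
    (z := (extChartAt 𝓘(ℝ, E) x).symm y) hy (mem_extChartAt_source _)
  rw [τ.pullback_id] at h
  rw [h]
  ext v
  have h2 : fderiv ℝ (chartExpr E E (id : M → M) x ((extChartAt 𝓘(ℝ, E) x).symm y)) y =
      (mfderiv 𝓘(ℝ, E) 𝓘(ℝ, E) (extChartAt 𝓘(ℝ, E) ((extChartAt 𝓘(ℝ, E) x).symm y))
        ((extChartAt 𝓘(ℝ, E) x).symm y)).comp
      (mfderiv 𝓘(ℝ, E) 𝓘(ℝ, E) (extChartAt 𝓘(ℝ, E) x).symm y) := by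
    rw [← mfderiv_comp y (mdifferentiableAt_extChartAt' (mem_extChartAt_source _))
      (mdifferentiableAt_extChartAt_symm hy), ← mfderiv_eq_fderiv]
    rfl
  rw [h2]
  rfl

theorem Form.pullback_mem_smoothForms {k : ℕ} {τ : Form E' N k} (hτ : τ ∈ smoothForms E' N k)
    {f : M → N} (hf : ContMDiff 𝓘(ℝ, E) 𝓘(ℝ, E') ∞ f) :
    (τ.pullback f : Form E M k) ∈ smoothForms E M k := by
  intro x y hy
  refine ContDiffAt.contDiffWithinAt ?_
  set z := f ((extChartAt 𝓘(ℝ, E) x).symm y)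
  have hz : z ∈ (extChartAt 𝓘(ℝ, E') z).source := mem_extChartAt_source _
  have hψ := contDiffAt_chartExpr hf hy hz
  have h1 : ContDiffAt ℝ ∞ (τ.inChart z ∘ chartExpr E E' f x z) y :=
    ContDiffAt.comp y ((hτ z).contDiffAt ((isOpen_extChartAt_target z).mem_nhds
      ((extChartAt 𝓘(ℝ, E') z).map_source hz))) hψ
  have h2 : ContDiffAt ℝ ∞ (fderiv ℝ (chartExpr E E' f x z)) y :=
    hψ.fderiv_right (m := ∞) (by simp)
  have h3 : ContDiffAt ℝ ∞ (fun w => (τ.inChart z (chartExpr E E' f x z w)).compContinuousLinearMap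
        (fderiv ℝ (chartExpr E E' f x z) w)) y :=
    h1.continuousAlternatingMap_compContinuousLinearMap h2
  refine h3.congr_of_eventuallyEq ?_
  filter_upwards [eventually_mem_target_source hf hy hz] with w hw
  exact τ.inChart_pullback hf hw.1 hw.2

theorem Form.d_pullback {k : ℕ} {τ : Form E' N k} (hτ : τ ∈ smoothForms E' N k)
    {f : M → N} (hf : ContMDiff 𝓘(ℝ, E) 𝓘(ℝ, E') ∞ f) :
    (τ.pullback f : Form E M k).d = τ.d.pullback f := by
  funext p
  have hp : (extChartAt 𝓘(ℝ, E) p).symm (extChartAt 𝓘(ℝ, E) p p) = p := extChartAt_to_inv p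
  have hfp : f ((extChartAt 𝓘(ℝ, E) p).symm (extChartAt 𝓘(ℝ, E) p p)) ∈
      (extChartAt 𝓘(ℝ, E') (f p)).source := by rw [hp]; exact mem_extChartAt_source _
  have h := extDeriv_inChart_pullback hτ hf (mem_extChartAt_target p) hfp
  have hψ : chartExpr E E' f p (f p) (extChartAt 𝓘(ℝ, E) p p) = extChartAt 𝓘(ℝ, E') (f p) (f p) :=
    congrArg (fun q => extChartAt 𝓘(ℝ, E') (f p) (f q)) hp
  rw [hψ] at h
  -- Both sides are the derivative at `p` of `f` followed by the chart at `f p`.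
  have h2 : (mfderiv 𝓘(ℝ, E) 𝓘(ℝ, E') (chartExpr E E' f p (f p)) (extChartAt 𝓘(ℝ, E) p p)).comp
      (mfderiv 𝓘(ℝ, E) 𝓘(ℝ, E) (extChartAt 𝓘(ℝ, E) p) p) =
      (mfderiv 𝓘(ℝ, E') 𝓘(ℝ, E') (extChartAt 𝓘(ℝ, E') (f p)) (f p)).comp
        (mfderiv 𝓘(ℝ, E) 𝓘(ℝ, E') f p) := by
    rw [← mfderiv_comp p (mdifferentiableAt_extChartAt' (mem_extChartAt_source _))
        (hf.mdifferentiable (by simp) _),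
      ← mfderiv_comp p ((contDiffAt_chartExpr hf (mem_extChartAt_target p) hfp).differentiableAt
        (by simp)).mdifferentiableAt (mdifferentiableAt_extChartAt' (mem_extChartAt_source _))]
    refine Filter.EventuallyEq.mfderiv_eq ?_
    filter_upwards [extChartAt_source_mem_nhds (I := 𝓘(ℝ, E)) p] with q hq
    exact congrArg (fun q => extChartAt 𝓘(ℝ, E') (f p) (f q)) ((extChartAt 𝓘(ℝ, E) p).left_inv hq)
  rw [mfderiv_eq_fderiv] at h2
  ext v
  rw [Form.d, h]
  exact congrArg (extDeriv (τ.inChart (f p)) (extChartAt 𝓘(ℝ, E') (f p) (f p)))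
    (funext fun i => DFunLike.congr_fun h2 (v i))

theorem Form.pullback_mem_closedForms {k : ℕ} {τ : Form E' N k} (hτ : τ ∈ closedForms E' N k)
    {f : M → N} (hf : ContMDiff 𝓘(ℝ, E) 𝓘(ℝ, E') ∞ f) :
    (τ.pullback f : Form E M k) ∈ closedForms E M k := by
  refine ⟨Form.pullback_mem_smoothForms hτ.1 hf, ?_⟩
  rw [Form.d_pullback hτ.1 hf, hτ.2]
  rfl

end Forms

/-! ### The Leibniz rule on a manifold; products of closed and exact forms -/

section WedgeForms

variable {E : Type*} [NormedAddCommGroup E] [NormedSpace ℝ E]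
  {M : Type*} [TopologicalSpace M] [ChartedSpace E M]

theorem Form.inChart_wedge {k l : ℕ} (α : Form E M k) (β : Form E M l) (x : M) :
    (α.wedge β).inChart x =
      fun y => PointwiseSlant.wedge (α.inChart x y) (β.inChart x y) := by
  funext y
  exact wedge_compContinuousLinearMap _ _ _

theorem Form.wedge_mem_smoothForms {k l : ℕ} {α : Form E M k} {β : Form E M l}
    (hα : α ∈ smoothForms E M k) (hβ : β ∈ smoothForms E M l) :
    α.wedge β ∈ smoothForms E M (k + l) := by
  intro x
  rw [Form.inChart_wedge]
  exact (isBoundedBilinearMap_wedge k l).contDiff.comp_contDiffOn ((hα x).prodMk (hβ x))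

theorem Form.zero_wedge {k l : ℕ} (β : Form E M l) : (0 : Form E M k).wedge β = 0 :=
  funext fun x => wedge_zero_left (β x)

theorem Form.wedge_zero {k l : ℕ} (α : Form E M k) : α.wedge (0 : Form E M l) = 0 :=
  funext fun x => wedge_zero_right (α x)

theorem Form.wedge_assoc_two {k l : ℕ} (α : Form E M k) (β : Form E M l) (τ : Form E M 2) :
    (α.wedge β).wedge τ = α.wedge (β.wedge τ) :=
  funext fun x => PointwiseSlant.wedge_assoc_two (α x) (β x) (τ x)

theorem Form.wedgePow_zero_mem_closedForms {k : ℕ} (τ : Form E M k) :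
    τ.wedgePow 0 ∈ closedForms E M (k * 0) := by
  have h : ∀ x : M, (τ.wedgePow 0).inChart x = fun _ =>
      haveI : IsEmpty (Fin (k * 0)) := Fin.isEmpty'
      ContinuousAlternatingMap.constOfIsEmpty ℝ E (Fin (k * 0)) 1 := fun x => rfl
  refine ⟨fun x => ?_, ?_⟩
  · rw [h]
    exact contDiffOn_const
  · funext x
    rw [Form.d, h]
    have h2 : extDeriv (fun _ : E =>
        haveI : IsEmpty (Fin (k * 0)) := Fin.isEmpty'
        ContinuousAlternatingMap.constOfIsEmpty ℝ E (Fin (k * 0)) (1 : ℝ))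
        (extChartAt 𝓘(ℝ, E) x x) = 0 := by
      ext v
      rw [extDeriv_apply (differentiableAt_const _)]
      simp
    rw [h2]
    rfl

variable [IsManifold 𝓘(ℝ, E) ∞ M]

/-- A form is recovered at the centre of a chart from its expression in the chart. -/
theorem Form.inChart_self {k : ℕ} (τ : Form E M k) (x : M) :
    (τ.inChart x (extChartAt 𝓘(ℝ, E) x x)).compContinuousLinearMap
      (mfderiv 𝓘(ℝ, E) 𝓘(ℝ, E) (extChartAt 𝓘(ℝ, E) x) x) = τ x := by
  have h : (mfderiv 𝓘(ℝ, E) 𝓘(ℝ, E) (extChartAt 𝓘(ℝ, E) x).symm (extChartAt 𝓘(ℝ, E) x x)).comp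
      (mfderiv 𝓘(ℝ, E) 𝓘(ℝ, E) (extChartAt 𝓘(ℝ, E) x) x) =
      mfderiv 𝓘(ℝ, E) 𝓘(ℝ, E) (id : M → M) x := by
    rw [← mfderiv_comp x (mdifferentiableAt_extChartAt_symm (mem_extChartAt_target x))
      (mdifferentiableAt_extChartAt' (mem_extChartAt_source x))]
    refine Filter.EventuallyEq.mfderiv_eq ?_
    filter_upwards [extChartAt_source_mem_nhds (I := 𝓘(ℝ, E)) x] with q hq
    exact (extChartAt 𝓘(ℝ, E) x).left_inv hq
  rw [mfderiv_id] at h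
  ext v
  refine Eq.trans ?_ (τ.apply_congr (extChartAt_to_inv (I := 𝓘(ℝ, E)) x) v)
  exact congrArg (τ ((extChartAt 𝓘(ℝ, E) x).symm (extChartAt 𝓘(ℝ, E) x x)) : E [⋀^Fin k]→L[ℝ] ℝ)
    (funext fun i => DFunLike.congr_fun h (v i))

theorem extDeriv_inChart_eq_zero {k : ℕ} {τ : Form E M k} (hτ : τ ∈ closedForms E M k) (x : M) :
    extDeriv (τ.inChart x) (extChartAt 𝓘(ℝ, E) x x) = 0 := by
  rw [← Form.inChart_d hτ.1 (mem_extChartAt_target x), hτ.2]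
  rfl

/-- With a right factor of the fixed degree `2`, the degrees `k + 2 + 1` and `k + 1 + 2` agree
definitionally and the cast in the Leibniz rule disappears. -/
theorem Form.d_wedge_of_closed_right {k : ℕ} {α : Form E M k} {τ : Form E M 2}
    (hα : α ∈ smoothForms E M k) (hτ : τ ∈ closedForms E M 2) :
    (α.wedge τ).d = α.d.wedge τ := by
  funext x
  ext v
  rw [Form.d, Form.inChart_wedge]
  refine (extDeriv_wedge (differentiableAt_inChart hα x) (differentiableAt_inChart hτ.1 x) _).trans
    ?_
  rw [extDeriv_inChart_eq_zero hτ, PointwiseSlant.wedge_zero_right]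
  refine Eq.trans (add_eq_left.2 ?_) ?_
  · exact mul_zero _
  · have h1 := wedge_compContinuousLinearMap
      (extDeriv (α.inChart x) (extChartAt 𝓘(ℝ, E) x x)) (τ.inChart x (extChartAt 𝓘(ℝ, E) x x))
      (mfderiv 𝓘(ℝ, E) 𝓘(ℝ, E) (extChartAt 𝓘(ℝ, E) x) x)
    rw [τ.inChart_self] at h1
    exact DFunLike.congr_fun h1 v

theorem Form.d_wedge_of_closed_left {k l : ℕ} {α : Form E M k} {β : Form E M l}
    (hα : α ∈ closedForms E M k) (hβ : β ∈ smoothForms E M l) :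
    (α.wedge β).d = (-1 : ℝ) ^ k • α.wedge β.d := by
  funext x
  ext v
  rw [Form.d, Form.inChart_wedge]
  refine (extDeriv_wedge (differentiableAt_inChart hα.1 x) (differentiableAt_inChart hβ x) _).trans
    ?_
  rw [extDeriv_inChart_eq_zero hα, PointwiseSlant.wedge_zero_left]
  refine Eq.trans (add_eq_right.2 rfl) ?_
  have h1 := wedge_compContinuousLinearMap (α.inChart x (extChartAt 𝓘(ℝ, E) x x))
      (extDeriv (β.inChart x) (extChartAt 𝓘(ℝ, E) x x))
      (mfderiv 𝓘(ℝ, E) 𝓘(ℝ, E) (extChartAt 𝓘(ℝ, E) x) x)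
  rw [α.inChart_self] at h1
  exact congrArg _ (DFunLike.congr_fun h1 v)

theorem Form.wedge_mem_closedForms {k l : ℕ} {α : Form E M k} {β : Form E M l}
    (hα : α ∈ closedForms E M k) (hβ : β ∈ closedForms E M l) :
    α.wedge β ∈ closedForms E M (k + l) := by
  refine ⟨Form.wedge_mem_smoothForms hα.1 hβ.1, ?_⟩
  rw [Form.d_wedge_of_closed_left hα hβ.1, hβ.2, Form.wedge_zero, smul_zero]

theorem Form.wedgePow_two_mem_closedForms {τ : Form E M 2}
    (hτ : τ ∈ closedForms E M 2) (j : ℕ) : τ.wedgePow j ∈ closedForms E M (2 * j) := by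
  induction j with
  | zero => exact Form.wedgePow_zero_mem_closedForms τ
  | succ j ih => exact Form.wedge_mem_closedForms ih hτ

theorem Form.wedge_mem_exactForms_right {k : ℕ} {α : Form E M k} {τ : Form E M 2}
    (hα : α ∈ exactForms E M k) (hτ : τ ∈ closedForms E M 2) :
    α.wedge τ ∈ exactForms E M (k + 2) := by
  cases k with
  | zero =>
    have h0 : α = 0 := hα
    rw [h0, Form.zero_wedge]
    exact zero_mem _
  | succ k =>
    obtain ⟨h1, β, hβ, rfl⟩ := hα
    exact ⟨Form.wedge_mem_smoothForms h1 hτ.1, β.wedge τ, Form.wedge_mem_smoothForms hβ hτ.1,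
      Form.d_wedge_of_closed_right hβ hτ⟩

theorem Form.wedge_mem_exactForms_left {k l : ℕ} {α : Form E M k} {β : Form E M l}
    (hα : α ∈ closedForms E M k) (hβ : β ∈ exactForms E M l) :
    α.wedge β ∈ exactForms E M (k + l) := by
  cases l with
  | zero =>
    have h0 : β = 0 := hβ
    rw [h0, Form.wedge_zero]
    exact zero_mem _
  | succ l =>
    obtain ⟨h1, γ, hγ, rfl⟩ := hβ
    -- The sign of the primitive cancels the one from the Leibniz rule.
    refine ⟨Form.wedge_mem_smoothForms hα.1 h1, (-1 : ℝ) ^ k • α.wedge γ,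
      Submodule.smul_mem _ _ (Form.wedge_mem_smoothForms hα.1 hγ), ?_⟩
    rw [Form.d_smul, Form.d_wedge_of_closed_left hα hγ, smul_smul, ← mul_pow]
    simp

theorem deRhamClass_ne_zero_iff {E M : Type*} [NormedAddCommGroup E] [NormedSpace ℝ E]
    [TopologicalSpace M] [ChartedSpace E M] {k : ℕ} {τ : Form E M k} (hτ : τ ∈ closedForms E M k) :
    deRhamClass τ hτ ≠ 0 ↔ τ ∉ exactForms E M k :=
  not_congr ((Submodule.Quotient.mk_eq_zero _).trans Iff.rfl)

end WedgeForms

/-! ### Integration of exact forms -/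

section EuclideanStokes

open MeasureTheory Measure

variable {E : Type*} [NormedAddCommGroup E] [NormedSpace ℝ E]

section

variable [FiniteDimensional ℝ E] [MeasurableSpace E] [BorelSpace E] (μ : Measure E)
  [μ.IsAddHaarMeasure]

/-- Integration by parts against the constant `1`. -/
theorem integral_fderiv_apply_eq_zero {g : E → ℝ} (hg : ContDiff ℝ 1 g) (hc : HasCompactSupport g)
    (v : E) : ∫ x, fderiv ℝ g x v ∂μ = 0 := by
  have hcont : Continuous fun x => fderiv ℝ g x v :=
    (hg.continuous_fderiv (by simp)).clm_apply continuous_const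
  have h := integral_bilinear_fderiv_right_eq_neg_left_of_integrable (μ := μ)
    (f := fun _ : E => (1 : ℝ)) (g := g) (v := v) (B := ContinuousLinearMap.mul ℝ ℝ)
    (by simp) (by simpa using hcont.integrable_of_hasCompactSupport (hc.fderiv_apply (𝕜 := ℝ) v))
    (by simpa using hg.continuous.integrable_of_hasCompactSupport hc)
    (fun x _ => differentiableAt_const _) (fun x _ => hg.differentiable (by simp) x)
  simpa using h

/-- Stokes' theorem for a compactly supported form on a vector space. -/
theorem integral_extDeriv_apply_eq_zero {k : ℕ} {β : E → E [⋀^Fin k]→L[ℝ] ℝ}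
    (hβ : ContDiff ℝ 1 β) (hc : HasCompactSupport β) (v : Fin (k + 1) → E) :
    ∫ x, extDeriv β x v ∂μ = 0 := by
  have hd : ∀ x, DifferentiableAt ℝ β x := hβ.differentiable (by simp)
  have h1 : ∀ (w : Fin k → E), ContDiff ℝ 1 fun x => β x w := fun w =>
    (ContinuousAlternatingMap.apply ℝ E ℝ w).contDiff.comp hβ
  have h2 : ∀ (w : Fin k → E), HasCompactSupport fun x => β x w := fun w =>
    hc.comp_left (g := fun α : E [⋀^Fin k]→L[ℝ] ℝ => α w) rfl
  have h3 : ∀ (w : Fin k → E) (u : E), Integrable (fun x => fderiv ℝ (fun x => β x w) x u) μ :=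
    fun w u => (((h1 w).continuous_fderiv (by simp)).clm_apply
      continuous_const).integrable_of_hasCompactSupport ((h2 w).fderiv_apply (𝕜 := ℝ) u)
  simp only [extDeriv_apply (hd _), zsmul_eq_mul]
  rw [integral_finsetSum _ fun i _ => (h3 _ _).const_mul _]
  refine Finset.sum_eq_zero fun i _ => ?_
  rw [integral_const_mul, integral_fderiv_apply_eq_zero μ (h1 _) (h2 _), mul_zero]

end

/-- This determinant is the Jacobian of the change of variables between charts. -/
theorem compContinuousLinearMap_basis {ι : Type*} [Fintype ι] [DecidableEq ι]
    (b : Module.Basis ι ℝ E) (τ : E [⋀^ι]→L[ℝ] ℝ) (A : E →L[ℝ] E) :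
    τ.compContinuousLinearMap A b = A.det * τ b := by
  have h := DFunLike.congr_fun (τ.toAlternatingMap.eq_smul_basis_det b) (A ∘ b)
  have h2 := b.det_comp (A : E →ₗ[ℝ] E) b
  rw [b.det_self, mul_one] at h2
  rw [AlternatingMap.smul_apply] at h
  change τ (A ∘ b) = τ b • b.det (A ∘ b) at h
  change b.det (A ∘ b) = _ at h2
  change τ (A ∘ b) = _
  rw [h, h2, smul_eq_mul, mul_comm]

theorem continuousAlternatingMap_eq_zero_iff {ι : Type*} [Fintype ι] [DecidableEq ι]
    (b : Module.Basis ι ℝ E) (τ : E [⋀^ι]→L[ℝ] ℝ) : τ = 0 ↔ τ b = 0 := by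
  refine ⟨fun h => by rw [h]; rfl, fun h => ?_⟩
  ext v
  have h1 := DFunLike.congr_fun (τ.toAlternatingMap.eq_smul_basis_det b) v
  rw [AlternatingMap.smul_apply] at h1
  change τ v = τ b • b.det v at h1
  rw [h1, h, zero_smul]
  rfl

theorem eq_div_smul_of_apply_basis_ne_zero {ι : Type*} [Fintype ι] [DecidableEq ι]
    (b : Module.Basis ι ℝ E) (σ τ : E [⋀^ι]→L[ℝ] ℝ) (h : τ b ≠ 0) : σ = (σ b / τ b) • τ := by
  rw [← sub_eq_zero, continuousAlternatingMap_eq_zero_iff b, ContinuousAlternatingMap.sub_apply,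
    ContinuousAlternatingMap.smul_apply, smul_eq_mul, div_mul_cancel₀ _ h, sub_self]

end EuclideanStokes

theorem Form.continuousOn_inChart_apply {E M : Type*} [NormedAddCommGroup E] [NormedSpace ℝ E]
    [TopologicalSpace M] [ChartedSpace E M] {k : ℕ} {ν : Form E M k} (hν : ν ∈ smoothForms E M k) (x : M)
    (v : Fin k → E) :
    ContinuousOn (fun y => ν.inChart x y v) (extChartAt 𝓘(ℝ, E) x).target :=
  (ContinuousAlternatingMap.apply ℝ E ℝ v).continuous.comp_continuousOn (hν x).continuousOn

/-! ### Densities in charts and their independence of the chart -/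

section Density

open MeasureTheory Measure Set

variable {E : Type*} [NormedAddCommGroup E] [NormedSpace ℝ E]
  [MeasurableSpace E] [BorelSpace E] (μ : Measure E) [μ.IsAddHaarMeasure]
  {M : Type*} [TopologicalSpace M] [ChartedSpace E M]
  {k : ℕ} (b : Module.Basis (Fin k) ℝ E)

/-- The integral of a function over a chart domain, with respect to the density given by the
absolute value of a form of top degree. -/
noncomputable def chartIntegral (ν : Form E M k) (x : M) (u : M → ℝ) : ℝ :=
  ∫ y in (extChartAt 𝓘(ℝ, E) x).target, u ((extChartAt 𝓘(ℝ, E) x).symm y) * |ν.inChart x y b| ∂μ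

theorem integrableOn_chartIntegral {ν : Form E M k} (hν : ν ∈ smoothForms E M k) {x : M}
    {u : M → ℝ} (hu : Continuous u) {K : Set M} (hK : IsCompact K)
    (hKx : K ⊆ (extChartAt 𝓘(ℝ, E) x).source) (huK : ∀ z, z ∉ K → u z = 0) :
    IntegrableOn (fun y => u ((extChartAt 𝓘(ℝ, E) x).symm y) * |ν.inChart x y b|)
      (extChartAt 𝓘(ℝ, E) x).target μ := by
  have hcont : ContinuousOn (fun y => u ((extChartAt 𝓘(ℝ, E) x).symm y) * |ν.inChart x y b|)
      (extChartAt 𝓘(ℝ, E) x).target :=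
    (hu.comp_continuousOn (continuousOn_extChartAt_symm x)).mul
      (Form.continuousOn_inChart_apply hν x b).abs
  have hsub : extChartAt 𝓘(ℝ, E) x '' K ⊆ (extChartAt 𝓘(ℝ, E) x).target := by
    rintro _ ⟨z, hz, rfl⟩
    exact (extChartAt 𝓘(ℝ, E) x).map_source (hKx hz)
  have hcpt : IsCompact (extChartAt 𝓘(ℝ, E) x '' K) :=
    hK.image_of_continuousOn ((continuousOn_extChartAt x).mono hKx)
  refine ((hcont.mono hsub).integrableOn_compact hcpt).of_forall_sdiff_eq_zero
    (isOpen_extChartAt_target x).measurableSet fun y hy => ?_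
  rw [huK _ fun h => hy.2 ⟨_, h, (extChartAt 𝓘(ℝ, E) x).right_inv hy.1⟩, zero_mul]

variable [FiniteDimensional ℝ E] [IsManifold 𝓘(ℝ, E) ∞ M]

/-- Both integrals live on the overlap. There the coefficient of `ν` changes by the determinant of
the transition map, and the change of variables formula supplies its absolute value; taking `|ν|`
makes the two match without an orientation. -/
theorem chartIntegral_eq (ν : Form E M k) {x z : M} {u : M → ℝ}
    (hu : ∀ p, u p ≠ 0 → p ∈ (extChartAt 𝓘(ℝ, E) x).source ∧ p ∈ (extChartAt 𝓘(ℝ, E) z).source) :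
    chartIntegral μ b ν x u = chartIntegral μ b ν z u := by
  set φ := extChartAt 𝓘(ℝ, E) x
  set ψ := extChartAt 𝓘(ℝ, E) z
  have hopen : ∀ x z : M, IsOpen ((extChartAt 𝓘(ℝ, E) x).target ∩
      (extChartAt 𝓘(ℝ, E) x).symm ⁻¹' (extChartAt 𝓘(ℝ, E) z).source) := fun x z =>
    (continuousOn_extChartAt_symm x).isOpen_inter_preimage (isOpen_extChartAt_target x)
      (isOpen_extChartAt_source z)
  have hrestr : ∀ x z : M, (∀ p, u p ≠ 0 → p ∈ (extChartAt 𝓘(ℝ, E) z).source) →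
      chartIntegral μ b ν x u = ∫ y in (extChartAt 𝓘(ℝ, E) x).target ∩
      (extChartAt 𝓘(ℝ, E) x).symm ⁻¹' (extChartAt 𝓘(ℝ, E) z).source,
        u ((extChartAt 𝓘(ℝ, E) x).symm y) * |ν.inChart x y b| ∂μ := by
    intro x z h
    refine setIntegral_eq_of_subset_of_forall_sdiff_eq_zero
      (isOpen_extChartAt_target x).measurableSet inter_subset_left fun y hy => ?_
    have : u ((extChartAt 𝓘(ℝ, E) x).symm y) = 0 := by
      by_contra h0
      exact hy.2 ⟨hy.1, h _ h0⟩
    rw [this, zero_mul]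
  rw [hrestr x z fun p hp => (hu p hp).2, hrestr z x fun p hp => (hu p hp).1]
  have himage : chartExpr E E (id : M → M) x z '' (φ.target ∩ φ.symm ⁻¹' ψ.source) =
      ψ.target ∩ ψ.symm ⁻¹' φ.source := by
    ext w
    constructor
    · rintro ⟨y, ⟨hy, hyz⟩, rfl⟩
      refine ⟨ψ.map_source hyz, ?_⟩
      change ψ.symm (ψ (φ.symm y)) ∈ φ.source
      rw [ψ.left_inv hyz]
      exact φ.map_target hy
    · rintro ⟨hw, hwx⟩
      refine ⟨φ (ψ.symm w), ⟨φ.map_source hwx, ?_⟩, ?_⟩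
      · change φ.symm (φ (ψ.symm w)) ∈ ψ.source
        rw [φ.left_inv hwx]
        exact ψ.map_target hw
      · change ψ (φ.symm (φ (ψ.symm w))) = w
        rw [φ.left_inv hwx, ψ.right_inv hw]
  have hinj : InjOn (chartExpr E E (id : M → M) x z) (φ.target ∩ φ.symm ⁻¹' ψ.source) := by
    intro y hy y' hy' h
    exact φ.symm.injOn hy.1 hy'.1 (ψ.injOn hy.2 hy'.2 h)
  rw [← himage, integral_image_eq_integral_abs_det_fderiv_smul μ (hopen x z).measurableSet
    (fun y hy => ((contDiffAt_chartExpr (f := (id : M → M)) contMDiff_id hy.1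
      hy.2).differentiableAt (by simp)).hasFDerivAt.hasFDerivWithinAt) hinj]
  refine setIntegral_congr_fun (hopen x z).measurableSet fun y hy => ?_
  have h1 : ψ.symm (chartExpr E E (id : M → M) x z y) = φ.symm y := ψ.left_inv hy.2
  simp only [smul_eq_mul]
  rw [h1, ν.inChart_eq hy.1 hy.2, compContinuousLinearMap_basis, abs_mul]
  ring

end Density

/-! ### Stokes' theorem for a form supported in one chart -/

section ManifoldStokes

open MeasureTheory Measure Set

variable {E : Type*} [NormedAddCommGroup E] [NormedSpace ℝ E]
  {M : Type*} [TopologicalSpace M] [ChartedSpace E M]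

theorem extDeriv_const_zero {k : ℕ} (y : E) :
    extDeriv (fun _ : E => (0 : E [⋀^Fin k]→L[ℝ] ℝ)) y = 0 := by
  have h := extDeriv_smul (x := y) (0 : ℝ) (fun _ : E => (0 : E [⋀^Fin k]→L[ℝ] ℝ))
  rwa [zero_smul, zero_smul] at h

theorem Form.d_sum {k : ℕ} {γ : Type*} (s : Finset γ) {β : γ → Form E M k}
    (hβ : ∀ i ∈ s, β i ∈ smoothForms E M k) : Form.d (∑ i ∈ s, β i) = ∑ i ∈ s, (β i).d := by
  classical
  induction s using Finset.induction_on with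
  | empty => exact Form.d_zero
  | insert i s hi ih =>
    rw [Finset.sum_insert hi, Finset.sum_insert hi,
      Form.d_add (hβ i (Finset.mem_insert_self i s))
        (Submodule.sum_mem _ fun j hj => hβ j (Finset.mem_insert_of_mem hj)),
      ih fun j hj => hβ j (Finset.mem_insert_of_mem hj)]

/-- The product of a form by a function. -/
noncomputable def Form.mulFun {k : ℕ} (h : M → ℝ) (α : Form E M k) : Form E M k := fun p => h p • α p

theorem Form.d_eq_zero_of_eventuallyEq {k : ℕ} {β : Form E M k} {p : M}
    (h : ∀ᶠ q in 𝓝 p, β q = 0) : β.d p = 0 := by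
  have h1 : β.inChart p =ᶠ[𝓝 (extChartAt 𝓘(ℝ, E) p p)] fun _ => 0 := by
    have hc : ContinuousAt (extChartAt 𝓘(ℝ, E) p).symm (extChartAt 𝓘(ℝ, E) p p) :=
      (continuousOn_extChartAt_symm p).continuousAt (extChartAt_target_mem_nhds p)
    have hp : (extChartAt 𝓘(ℝ, E) p).symm (extChartAt 𝓘(ℝ, E) p p) = p := extChartAt_to_inv p
    rw [ContinuousAt, hp] at hc
    filter_upwards [hc.eventually h] with y hy
    rw [Form.inChart, hy]
    rfl
  rw [Form.d, h1.extDeriv_eq, extDeriv_const_zero]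
  rfl

variable [IsManifold 𝓘(ℝ, E) ∞ M]

theorem Form.mulFun_mem_smoothForms {k : ℕ} {h : M → ℝ} (hh : ContMDiff 𝓘(ℝ, E) 𝓘(ℝ) ∞ h)
    {α : Form E M k} (hα : α ∈ smoothForms E M k) : Form.mulFun h α ∈ smoothForms E M k := by
  intro x
  have h1 : ContDiffOn ℝ ∞ (h ∘ (extChartAt 𝓘(ℝ, E) x).symm) (extChartAt 𝓘(ℝ, E) x).target := by
    rw [← contMDiffOn_iff_contDiffOn]
    exact hh.comp_contMDiffOn (contMDiffOn_extChartAt_symm x)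
  exact h1.smul (hα x)

variable {k : ℕ} (b : Module.Basis (Fin k) ℝ E)

/-- A zero coefficient kills the top-degree form in the chart at `x`, hence also in the chart
centred at the corresponding point, where it determines `ν`. -/
theorem Form.inChart_apply_ne_zero {ν : Form E M k} (hν : ∀ p, ν p ≠ 0) {x : M} {y : E}
    (hy : y ∈ (extChartAt 𝓘(ℝ, E) x).target) : ν.inChart x y b ≠ 0 := by
  intro h
  have h0 := (continuousAlternatingMap_eq_zero_iff b _).2 h
  set p := (extChartAt 𝓘(ℝ, E) x).symm y
  have hp : (extChartAt 𝓘(ℝ, E) p).symm (extChartAt 𝓘(ℝ, E) p p) = p := extChartAt_to_inv p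
  have hpx : p ∈ (extChartAt 𝓘(ℝ, E) x).source := (extChartAt 𝓘(ℝ, E) x).map_target hy
  have h1 := ν.inChart_eq (mem_extChartAt_target p) (z := x) (by rw [hp]; exact hpx)
  have h2 : chartExpr E E (id : M → M) p x (extChartAt 𝓘(ℝ, E) p p) = y :=
    (congrArg (extChartAt 𝓘(ℝ, E) x) hp).trans ((extChartAt 𝓘(ℝ, E) x).right_inv hy)
  rw [h2, h0] at h1
  apply hν p
  rw [← ν.inChart_self p, h1]
  rfl

/-- Locally `u` is a quotient of coefficients. Only continuity is asked of `τ`, which for exterior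
derivatives is what `Form.continuousOn_inChart_d_apply` provides. -/
theorem Form.continuous_of_eq_smul {ν τ : Form E M k} (hν : ν ∈ smoothForms E M k)
    (hν0 : ∀ p, ν p ≠ 0) (hτ : ∀ x, ContinuousOn (fun y => τ.inChart x y b)
      (extChartAt 𝓘(ℝ, E) x).target) {u : M → ℝ} (hu : ∀ p, τ p = u p • ν p) : Continuous u := by
  rw [continuous_iff_continuousAt]
  intro x
  have h1 : ContinuousAt (fun y => τ.inChart x y b / ν.inChart x y b) (extChartAt 𝓘(ℝ, E) x x) :=
    ((hτ x).div (Form.continuousOn_inChart_apply hν x b) fun y hy =>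
      Form.inChart_apply_ne_zero b hν0 hy).continuousAt (extChartAt_target_mem_nhds x)
  refine (ContinuousAt.comp (f := extChartAt 𝓘(ℝ, E) x) h1
    (continuousAt_extChartAt x)).congr ?_
  filter_upwards [extChartAt_source_mem_nhds (I := 𝓘(ℝ, E)) x] with z hz
  have hz' := (extChartAt 𝓘(ℝ, E) x).map_source hz
  have h2 : τ.inChart x (extChartAt 𝓘(ℝ, E) x z) b =
      u ((extChartAt 𝓘(ℝ, E) x).symm (extChartAt 𝓘(ℝ, E) x z)) *
        ν.inChart x (extChartAt 𝓘(ℝ, E) x z) b := by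
    rw [Form.inChart, hu]
    rfl
  rw [Function.comp_apply, h2, (extChartAt 𝓘(ℝ, E) x).left_inv hz,
    mul_div_cancel_right₀ _ (Form.inChart_apply_ne_zero b hν0 hz')]

theorem Form.continuousOn_inChart_d_apply {β : Form E M k} (hβ : β ∈ smoothForms E M k) (x : M)
    (v : Fin (k + 1) → E) :
    ContinuousOn (fun y => β.d.inChart x y v) (extChartAt 𝓘(ℝ, E) x).target := by
  have h1 : ContinuousOn (fun y => extDeriv (β.inChart x) y) (extChartAt 𝓘(ℝ, E) x).target :=
    (ContinuousAlternatingMap.alternatizeUncurryFinCLM ℝ E ℝ).continuous.comp_continuousOn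
      ((hβ x).continuousOn_fderiv_of_isOpen (isOpen_extChartAt_target x) (by simp))
  refine ((ContinuousAlternatingMap.apply ℝ E ℝ v).continuous.comp_continuousOn h1).congr
    fun y hy => ?_
  rw [Form.inChart_d hβ hy]
  rfl

variable [FiniteDimensional ℝ E] [MeasurableSpace E] [BorelSpace E] (μ : Measure E)
  [μ.IsAddHaarMeasure]

/-- The sign of the coefficient of `ν` is locally constant on the chart target. So the integrand is
the coefficient of the exterior derivative of `±β`, and Stokes on `E` applies after extension by
zero. -/
theorem chartIntegral_eq_zero (b : Module.Basis (Fin (k + 1)) ℝ E) {ν : Form E M (k + 1)}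
    (hν : ν ∈ smoothForms E M (k + 1)) (hν0 : ∀ p, ν p ≠ 0) {β : Form E M k}
    (hβ : β ∈ smoothForms E M k) {x : M} {K : Set M} (hK : IsCompact K)
    (hKx : K ⊆ (extChartAt 𝓘(ℝ, E) x).source) (hβK : ∀ z, z ∉ K → β z = 0) {u : M → ℝ}
    (hu : ∀ p, β.d p = u p • ν p) : chartIntegral μ b ν x u = 0 := by
  have hto := isOpen_extChartAt_target (I := 𝓘(ℝ, E)) x
  set φ := extChartAt 𝓘(ℝ, E) x with hφ
  set w : E → ℝ := fun y => ν.inChart x y b with hw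
  have hwc : ContinuousOn w φ.target := Form.continuousOn_inChart_apply hν x b
  have hw0 : ∀ y ∈ φ.target, w y ≠ 0 := fun y hy => Form.inChart_apply_ne_zero b hν0 hy
  -- The sign of `w`; it may differ between components of the target, but it has zero derivative.
  let c : E → ℝ := fun y => |w y| / w y
  have hc : ∀ y ∈ φ.target, c =ᶠ[𝓝 y] fun _ => c y := by
    intro y hy
    have hcy := hwc.continuousAt (hto.mem_nhds hy)
    rcases (hw0 y hy).lt_or_gt with h | h
    · filter_upwards [hcy.eventually_lt_const h] with z hz
      simp only [c, abs_of_neg h, abs_of_neg hz, neg_div, div_self h.ne, div_self hz.ne]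
    · filter_upwards [hcy.eventually_const_lt h] with z hz
      simp only [c, abs_of_pos h, abs_of_pos hz, div_self h.ne', div_self hz.ne']
  let g : E → E [⋀^Fin k]→L[ℝ] ℝ := φ.target.indicator fun y => c y • β.inChart x y
  have hg1 : ∀ y ∈ φ.target, g =ᶠ[𝓝 y] c y • β.inChart x := by
    intro y hy
    filter_upwards [hc y hy, hto.mem_nhds hy] with z hz hz'
    simp only [g, indicator_of_mem hz', hz, Pi.smul_apply]
  have hcpt : IsCompact (φ '' K) := hK.image_of_continuousOn ((continuousOn_extChartAt x).mono hKx)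
  have hg2 : ∀ y, y ∉ φ '' K → g y = 0 := by
    intro y hy
    by_cases hyt : y ∈ φ.target
    · have h1 : β (φ.symm y) = 0 := hβK _ fun h => hy ⟨_, h, φ.right_inv hyt⟩
      simp only [g, indicator_of_mem hyt]
      rw [Form.inChart, h1]
      exact smul_zero _
    · exact indicator_of_notMem hyt _
  have hgs : ContDiff ℝ 1 g := by
    rw [contDiff_iff_contDiffAt]
    intro y
    by_cases hyt : y ∈ φ.target
    · refine ContDiffAt.congr_of_eventuallyEq ?_ (hg1 y hyt)
      exact contDiffAt_const.smul (((hβ x).contDiffAt (hto.mem_nhds hyt)).of_le (by simp))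
    · have hy : y ∉ φ '' K := by
        rintro ⟨z, hz, rfl⟩
        exact hyt (φ.map_source (hKx hz))
      refine ContDiffAt.congr_of_eventuallyEq (contDiffAt_const (c := 0)) ?_
      filter_upwards [hcpt.isClosed.isOpen_compl.mem_nhds hy] with z hz
      exact hg2 z hz
  have hgc : HasCompactSupport g := HasCompactSupport.intro hcpt hg2
  rw [← integral_extDeriv_apply_eq_zero μ hgs hgc b, chartIntegral]
  have hz : ∀ y, y ∉ φ.target → extDeriv g y b = 0 := by
    intro y hyt
    have hy : y ∉ φ '' K := by
      rintro ⟨z, hz, rfl⟩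
      exact hyt (φ.map_source (hKx hz))
    have h1 : g =ᶠ[𝓝 y] fun _ => 0 := by
      filter_upwards [hcpt.isClosed.isOpen_compl.mem_nhds hy] with z hz
      exact hg2 z hz
    rw [h1.extDeriv_eq, extDeriv_const_zero]
    rfl
  rw [← setIntegral_eq_integral_of_forall_compl_eq_zero hz]
  refine setIntegral_congr_fun hto.measurableSet fun y hy => ?_
  have h1 : β.d.inChart x y b = u (φ.symm y) * w y := by
    rw [Form.inChart, hu]
    rfl
  rw [(hg1 y hy).extDeriv_eq, extDeriv_smul, ← Form.inChart_d hβ hy,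
    ContinuousAlternatingMap.smul_apply, h1, smul_eq_mul]
  have h2 := hw0 y hy
  change u (φ.symm y) * |w y| = |w y| / w y * (u (φ.symm y) * w y)
  field_simp

end ManifoldStokes

/-! ### Stokes' theorem on a compact manifold -/

section CompactStokes

open MeasureTheory Measure Set

variable {E : Type*} [NormedAddCommGroup E] [NormedSpace ℝ E] [FiniteDimensional ℝ E]
  {M : Type*} [TopologicalSpace M] [ChartedSpace E M] [IsManifold 𝓘(ℝ, E) ∞ M]
  [T2Space M] [CompactSpace M] [Nonempty M]

/-- On a nonempty compact manifold, the exterior derivative of a smooth form of codegree one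
vanishes somewhere. -/
theorem Form.exists_d_eq_zero {k : ℕ} (hk : Module.finrank ℝ E = k + 1) {α : Form E M k}
    (hα : α ∈ smoothForms E M k) (hd : α.d ∈ smoothForms E M (k + 1)) : ∃ p, α.d p = 0 := by
  by_contra! hν0
  borelize E
  let μ : Measure E := addHaar
  let b : Module.Basis (Fin (k + 1)) ℝ E := Module.finBasisOfFinrankEq ℝ E hk
  obtain ⟨ρ, hρ⟩ := SmoothPartitionOfUnity.exists_isSubordinate_chartAt_source 𝓘(ℝ, E) M
  have hfin : {i | (Function.support (ρ i)).Nonempty}.Finite :=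
    ρ.locallyFinite.finite_nonempty_of_compact
  let s : Finset M := hfin.toFinset
  have hsum : ∀ x, ∑ i ∈ s, ρ i x = 1 := by
    intro x
    rw [← ρ.sum_eq_one (mem_univ x)]
    refine (finsum_eq_sum_of_support_subset _ fun i hi => ?_).symm
    exact hfin.mem_toFinset.2 ⟨x, hi⟩
  have hsub : ∀ i, tsupport (ρ i) ⊆ (extChartAt 𝓘(ℝ, E) i).source := fun i => by
    rw [extChartAt_source]
    exact hρ i
  have hKc : ∀ i, IsCompact (tsupport (ρ i)) := fun i => (isClosed_tsupport _).isCompact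
  have hρ0 : ∀ i z, z ∉ tsupport (ρ i) → ρ i z = 0 := fun i z h => image_eq_zero_of_notMem_tsupport h
  let β : M → Form E M k := fun i => Form.mulFun (ρ i) α
  have hβ : ∀ i, β i ∈ smoothForms E M k := fun i => Form.mulFun_mem_smoothForms (ρ i).contMDiff hα
  have hβsum : ∑ i ∈ s, (β i).d = α.d := by
    rw [← Form.d_sum s fun i _ => hβ i]
    congr 1
    funext x
    have h1 : (∑ i ∈ s, β i) x = ∑ i ∈ s, ρ i x • α x := Finset.sum_apply _ _ _
    rw [h1, ← Finset.sum_smul, hsum, one_smul]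
  -- The density of `d(ρ i • α)` relative to `dα`, which by assumption vanishes nowhere. These
  -- densities sum to `1`.
  let u : M → M → ℝ := fun i p =>
    ((β i).d p : E [⋀^Fin (k + 1)]→L[ℝ] ℝ) b / (α.d p : E [⋀^Fin (k + 1)]→L[ℝ] ℝ) b
  have hαb : ∀ p, (α.d p : E [⋀^Fin (k + 1)]→L[ℝ] ℝ) b ≠ 0 := fun p h =>
    hν0 p ((continuousAlternatingMap_eq_zero_iff b _).2 h)
  have hu : ∀ i p, (β i).d p = u i p • α.d p := fun i p =>
    eq_div_smul_of_apply_basis_ne_zero b _ _ (hαb p)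
  have huc : ∀ i, Continuous (u i) := fun i =>
    Form.continuous_of_eq_smul b hd hν0 (fun x => Form.continuousOn_inChart_d_apply (hβ i) x b)
      (hu i)
  have husum : ∀ p, ∑ i ∈ s, u i p = 1 := by
    intro p
    have h1 : (∑ i ∈ s, (β i).d) p = ∑ i ∈ s, u i p • α.d p :=
      (Finset.sum_apply _ _ _).trans (Finset.sum_congr rfl fun i _ => hu i p)
    rw [hβsum, ← Finset.sum_smul] at h1
    have h2 : (α.d p : E [⋀^Fin (k + 1)]→L[ℝ] ℝ) b =
        (∑ i ∈ s, u i p) * (α.d p : E [⋀^Fin (k + 1)]→L[ℝ] ℝ) b :=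
      congrArg (fun t : E [⋀^Fin (k + 1)]→L[ℝ] ℝ => t b) h1
    exact (right_eq_mul₀ (hαb p)).1 h2
  have hu0 : ∀ i z, z ∉ tsupport (ρ i) → u i z = 0 := by
    intro i z hz
    have h : (β i).d z = 0 := by
      refine Form.d_eq_zero_of_eventuallyEq ?_
      filter_upwards [(isClosed_tsupport (ρ i)).isOpen_compl.mem_nhds hz] with q hq
      change ρ i q • α q = 0
      rw [hρ0 i q hq, zero_smul]
    simp only [u]
    rw [h]
    exact zero_div _
  let J : M → (M → ℝ) → ℝ := chartIntegral μ b α.d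
  have hJ1 : ∀ i, J i (u i) = 0 := fun i =>
    chartIntegral_eq_zero μ b hd hν0 (hβ i) (hKc i) (hsub i) (fun z hz => by
      change ρ i z • α z = 0
      rw [hρ0 i z hz, zero_smul]) (hu i)
  have hJ2 : ∀ i j, J j (fun p => ρ j p * u i p) = J i (fun p => ρ j p * u i p) := fun i j =>
    chartIntegral_eq μ b _ fun p hp =>
      ⟨hsub j (by_contra fun h => hp (by simp only [hρ0 j p h, zero_mul])),
        hsub i (by_contra fun h => hp (by simp only [hu0 i p h, mul_zero]))⟩
  have hJsum : ∀ (x : M) (v : M → M → ℝ) (_ : ∀ i, Continuous (v i))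
      (_ : ∀ i z, z ∉ tsupport (ρ x) → v i z = 0),
      J x (fun p => ∑ i ∈ s, v i p) = ∑ i ∈ s, J x (v i) := by
    intro x v hv hv0
    simp only [J, chartIntegral, Finset.sum_mul]
    exact integral_finsetSum _ fun i _ =>
      integrableOn_chartIntegral μ b hd (hv i) (hKc x) (hsub x) (hv0 i)
  -- The total integral of `|dα|`. Insert `1 = ∑ u i`, move each term `ρ j * u i` from chart `j` to
  -- chart `i`, and sum over `j` to reach `J i (u i) = 0`.
  have hJ3 : ∑ j ∈ s, J j (ρ j) = 0 := by
    have h1 : ∀ j, J j (ρ j) = ∑ i ∈ s, J j (fun p => ρ j p * u i p) := by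
      intro j
      rw [← hJsum j (fun i p => ρ j p * u i p) (fun i => (ρ j).contMDiff.continuous.mul (huc i))
        fun i z hz => by simp only [hρ0 j z hz, zero_mul]]
      congr 1
      funext p
      rw [← Finset.mul_sum, husum, mul_one]
    have h2 : ∀ i, ∑ j ∈ s, J i (fun p => ρ j p * u i p) = 0 := by
      intro i
      rw [← hJsum i (fun j p => ρ j p * u i p) (fun j => (ρ j).contMDiff.continuous.mul (huc i))
        fun j z hz => by simp only [hu0 i z hz, mul_zero], ← hJ1 i]
      congr 1
      funext p
      rw [← Finset.sum_mul, hsum, one_mul]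
    rw [Finset.sum_congr rfl fun j _ => h1 j, Finset.sum_comm]
    refine Finset.sum_eq_zero fun i _ => ?_
    rw [Finset.sum_congr rfl fun j _ => hJ2 i j, h2]
  have hnonneg : ∀ j, J j (ρ j) ≥ 0 := fun j =>
    setIntegral_nonneg (isOpen_extChartAt_target j).measurableSet fun y _ =>
      mul_nonneg (ρ.nonneg j _) (abs_nonneg _)
  obtain ⟨x⟩ := ‹Nonempty M›
  obtain ⟨j, hj, hjx⟩ : ∃ j ∈ s, ρ j x ≠ 0 := by
    by_contra! h
    have := hsum x
    rw [Finset.sum_eq_zero h] at this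
    exact zero_ne_one this
  -- The integrand is positive on the nonempty open set where `ρ j` does not vanish.
  have hpos : 0 < J j (ρ j) := by
    have hint := integrableOn_chartIntegral μ b hd (ρ j).contMDiff.continuous (hKc j) (hsub j) (hρ0 j)
    refine (setIntegral_pos_iff_support_of_nonneg_ae (Filter.Eventually.of_forall fun y =>
      mul_nonneg (ρ.nonneg j _) (abs_nonneg _)) hint).2 ?_
    have hopen : IsOpen ((extChartAt 𝓘(ℝ, E) j).target ∩
        (extChartAt 𝓘(ℝ, E) j).symm ⁻¹' (Function.support (ρ j))) :=
      (continuousOn_extChartAt_symm j).isOpen_inter_preimage (isOpen_extChartAt_target j)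
        (ρ j).contMDiff.continuous.isOpen_support
    have hxs : x ∈ (extChartAt 𝓘(ℝ, E) j).source := hsub j (subset_tsupport _ hjx)
    refine (hopen.measure_pos μ ⟨extChartAt 𝓘(ℝ, E) j x,
      (extChartAt 𝓘(ℝ, E) j).map_source hxs, ?_⟩).trans_le (measure_mono fun y hy => ?_)
    · change ρ j _ ≠ 0
      rwa [(extChartAt 𝓘(ℝ, E) j).left_inv hxs]
    · exact ⟨mul_ne_zero hy.2 (abs_ne_zero.2 (Form.inChart_apply_ne_zero b hν0 hy.1)), hy.1⟩
  exact (Finset.sum_pos' (fun j _ => hnonneg j) ⟨j, hj, hpos⟩).ne' hJ3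

/-- An exact form of top degree on a nonempty compact manifold vanishes somewhere. -/
theorem exists_eq_zero_of_mem_exactForms {k : ℕ} (hk : Module.finrank ℝ E = k) {τ : Form E M k}
    (hτ : τ ∈ exactForms E M k) : ∃ p, τ p = 0 := by
  cases k with
  | zero =>
    have h0 : τ = 0 := hτ
    obtain ⟨p⟩ := ‹Nonempty M›
    exact ⟨p, by rw [h0]; rfl⟩
  | succ k =>
    obtain ⟨h1, α, hα, rfl⟩ := hτ
    exact Form.exists_d_eq_zero hk hα h1

end CompactStokes

/-! ### Cohomology classes with nonvanishing top product -/

section Cohomology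

variable {E : Type*} [NormedAddCommGroup E] [NormedSpace ℝ E]
  {M : Type*} [TopologicalSpace M] [ChartedSpace E M]

theorem Form.wedge_wedgePow_zero {k : ℕ} (α : Form E M k) (τ : Form E M 2) :
    α.wedge (τ.wedgePow 0) = α := by
  funext x
  ext v
  refine (wedge_apply (α x) (PointwiseSlant.wedgePow (τ x) 0) v).trans ?_
  have h : antisym (fun w : Fin (k + 2 * 0) → TangentSpace 𝓘(ℝ, E) x =>
      α x (fun i => w (Fin.castAdd (2 * 0) i)) *
        PointwiseSlant.wedgePow (τ x) 0 (fun j => w (Fin.natAdd k j))) v = antisym (α x) v := by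
    congr 1
    funext w
    exact mul_one _
  have h0 : (k.factorial : ℝ) ≠ 0 := by positivity
  rw [h, antisym_continuousAlternatingMap]
  simp [h0]

variable [IsManifold 𝓘(ℝ, E) ∞ M] {η : Form E M 1} {Ω : Form E M 2}

theorem wedgePow_mem_exactForms_of_le (hΩ : Ω ∈ closedForms E M 2) {j m : ℕ} (hjm : j ≤ m)
    (h : Ω.wedgePow j ∈ exactForms E M (2 * j)) : Ω.wedgePow m ∈ exactForms E M (2 * m) := by
  induction m, hjm using Nat.le_induction with
  | base => exact h
  | succ m _ ih => exact Form.wedge_mem_exactForms_right ih hΩ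

theorem wedge_wedgePow_mem_exactForms_of_le (hΩ : Ω ∈ closedForms E M 2) {j m : ℕ} (hjm : j ≤ m)
    (h : η.wedge (Ω.wedgePow j) ∈ exactForms E M (1 + 2 * j)) :
    η.wedge (Ω.wedgePow m) ∈ exactForms E M (1 + 2 * m) := by
  induction m, hjm using Nat.le_induction with
  | base => exact h
  | succ m _ ih =>
    have h1 := Form.wedge_mem_exactForms_right ih hΩ
    rw [Form.wedge_assoc_two] at h1
    exact h1

variable [FiniteDimensional ℝ E] [T2Space M] [CompactSpace M] [Nonempty M]

/-- Multiplication by the closed form `Ω` preserves exactness, so exactness here would propagate to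
the top degree and force a zero of `η ∧ Ω^m`. -/
theorem wedge_wedgePow_notMem_exactForms {m : ℕ} (hm : Module.finrank ℝ E = 1 + 2 * m)
    (hΩ : Ω ∈ closedForms E M 2) (hne : ∀ p, η.wedge (Ω.wedgePow m) p ≠ 0) {j : ℕ}
    (hj : j ≤ m) :
    η.wedge (Ω.wedgePow j) ∉ exactForms E M (1 + 2 * j) := fun h =>
  let ⟨p, hp⟩ := exists_eq_zero_of_mem_exactForms hm (wedge_wedgePow_mem_exactForms_of_le hΩ hj h)
  hne p hp

theorem notMem_exactForms_one {m : ℕ} (hm : Module.finrank ℝ E = 1 + 2 * m)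
    (hΩ : Ω ∈ closedForms E M 2) (hne : ∀ p, η.wedge (Ω.wedgePow m) p ≠ 0) :
    η ∉ exactForms E M 1 := fun h => by
  have h1 := wedge_wedgePow_notMem_exactForms hm hΩ hne (Nat.zero_le m)
  rw [Form.wedge_wedgePow_zero] at h1
  exact h1 h

theorem wedgePow_notMem_exactForms {m : ℕ} (hm : Module.finrank ℝ E = 1 + 2 * m)
    (hη : η ∈ closedForms E M 1) (hΩ : Ω ∈ closedForms E M 2) (hne : ∀ p, η.wedge (Ω.wedgePow m) p ≠ 0)
    {j : ℕ} (hj : j ≤ m) :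
    Ω.wedgePow j ∉ exactForms E M (2 * j) := fun h =>
  let ⟨p, hp⟩ := exists_eq_zero_of_mem_exactForms hm
    (Form.wedge_mem_exactForms_left hη (wedgePow_mem_exactForms_of_le hΩ hj h))
  hne p hp

/-- The first power of `Ω` is by definition `1 ∧ Ω`, a product of a closed form with `Ω`, so
exactness of `Ω` would pass to it. -/
theorem notMem_exactForms_two {m : ℕ} (hm : Module.finrank ℝ E = 1 + 2 * m)
    (hη : η ∈ closedForms E M 1) (hΩ : Ω ∈ closedForms E M 2) (hne : ∀ p, η.wedge (Ω.wedgePow m) p ≠ 0)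
    (h1m : 1 ≤ m) : Ω ∉ exactForms E M 2 := fun h =>
  wedgePow_notMem_exactForms hm hη hΩ hne h1m
    (Form.wedge_mem_exactForms_left (Form.wedgePow_zero_mem_closedForms Ω) h)

theorem nontrivial_deRhamCohomology {m : ℕ} (hm : Module.finrank ℝ E = 1 + 2 * m)
    (hη : η ∈ closedForms E M 1) (hΩ : Ω ∈ closedForms E M 2) (hne : ∀ p, η.wedge (Ω.wedgePow m) p ≠ 0)
    {i : ℕ} (hi : i ≤ 2 * m + 1) :
    Nontrivial (DeRhamCohomology E M i) := by
  obtain ⟨j, rfl | rfl⟩ : ∃ j, i = 2 * j ∨ i = 1 + 2 * j := ⟨i / 2, by omega⟩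
  · exact ⟨deRhamClass _ (Form.wedgePow_two_mem_closedForms hΩ j), 0,
      (deRhamClass_ne_zero_iff _).2 (wedgePow_notMem_exactForms hm hη hΩ hne (by omega))⟩
  · exact ⟨deRhamClass _ (Form.wedge_mem_closedForms hη (Form.wedgePow_two_mem_closedForms hΩ j)), 0,
      (deRhamClass_ne_zero_iff _).2 (wedge_wedgePow_notMem_exactForms hm hΩ hne (by omega))⟩

end Cohomology

/-! ### The forms `η` and `Ω` on a proper pointwise slant submanifold -/

section SlantForms

variable {E : Type*} [NormedAddCommGroup E] [NormedSpace ℝ E] [FiniteDimensional ℝ E]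
  {M : Type*} [TopologicalSpace M] [ChartedSpace E M]
  {E' : Type*} [NormedAddCommGroup E'] [NormedSpace ℝ E']
  {N : Type*} [TopologicalSpace N] [ChartedSpace E' N]
  [IsManifold 𝓘(ℝ, E') ∞ N] [RiemannianBundle (fun x : N => TangentSpace 𝓘(ℝ, E') x)]
  (S : AlmostContactMetricStructure E' N) {f : M → N}

/-- The normal part of `φY` is orthogonal to every tangent vector. -/
theorem slantForm_eq_pullback (hf : IsSmoothImmersion E E' f) :
    slantForm S hf = S.fundamentalForm.pullback f := by
  funext p
  ext v
  exact inner_tangentialPart S hf p (v 0) (v 1)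

/-- The bilinear form `Ω` on a tangent space of the submanifold. -/
noncomputable def slantBilin (f : M → N) (p : M) :
    TangentSpace 𝓘(ℝ, E) p →ₗ[ℝ] TangentSpace 𝓘(ℝ, E) p →ₗ[ℝ] ℝ :=
  LinearMap.mk₂ ℝ (fun X Y => inner ℝ (mfderiv 𝓘(ℝ, E) 𝓘(ℝ, E') f p X)
      (S.φ (f p) (mfderiv 𝓘(ℝ, E) 𝓘(ℝ, E') f p Y)))
    (fun X X' Y => by rw [map_add, inner_add_left])
    (fun c X Y => by rw [map_smul, inner_smul_left]; rfl)
    (fun X Y Y' => by rw [map_add, map_add, inner_add_right])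
    (fun c X Y => by rw [map_smul, map_smul, inner_smul_right]; rfl)

/-- The witness is the projection of `φX` to `M_p`, whose inner product with `φX` is its own squared
norm. -/
theorem slantBilin_nondegenerate (hf : IsSmoothImmersion E E' f)
    (hslant : IsProperPointwiseSlant E S f) (p : M) (X : TangentSpace 𝓘(ℝ, E) p)
    (hX : S.η (f p) (mfderiv 𝓘(ℝ, E) 𝓘(ℝ, E') f p X) = 0) (hX0 : X ≠ 0) :
    ∃ Y, S.η (f p) (mfderiv 𝓘(ℝ, E) 𝓘(ℝ, E') f p Y) = 0 ∧ slantBilin S f p Y X ≠ 0 := by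
  obtain ⟨θ, hθ, hθ'⟩ := hslant
  set A := mfderiv 𝓘(ℝ, E) 𝓘(ℝ, E') f p
  have hmem : ∀ Z, Z ∈ slantSpace E S f p ↔ Z ∈ tangentImage E E' f p ∧ S.η (f p) Z = 0 := by
    intro Z
    rw [slantSpace, Submodule.mem_inf, Submodule.mem_orthogonal_singleton_iff_inner_left, S.inner_ξ]
  have hAX : A X ≠ 0 := fun h => hX0 (hf.injective_mfderiv p (h.trans (map_zero A).symm))
  have hangle := hθ p (A X) ((hmem _).2 ⟨⟨X, rfl⟩, hX⟩) hAX
  set P := (slantSpace E S f p).starProjection (S.φ (f p) (A X)) with hP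
  -- The angle with the zero vector is `π / 2` by convention, a value that a proper slant function
  -- excludes.
  have hP0 : P ≠ 0 := by
    intro h
    rw [h, InnerProductGeometry.angle_zero_right] at hangle
    exact (hθ' p).2.ne hangle.symm
  have hPm : P ∈ slantSpace E S f p := Submodule.starProjection_apply_mem _ _
  obtain ⟨⟨Y, hY⟩, hPη⟩ := (hmem P).1 hPm
  have hY' : A Y = P := hY
  refine ⟨Y, by rw [hY', hPη], ?_⟩
  change inner ℝ (A Y) (S.φ (f p) (A X)) ≠ 0
  have h1 : inner ℝ P (S.φ (f p) (A X)) = inner ℝ P P := by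
    conv_lhs => rw [← Submodule.starProjection_eq_self_iff.2 hPm]
    rw [Submodule.inner_starProjection_left_eq_right]
  rw [hY', h1]
  exact inner_self_ne_zero.2 hP0

theorem eta_wedge_slantForm_ne_zero {m : ℕ} (hm : Module.finrank ℝ E = 2 * m + 1)
    (hf : IsSmoothImmersion E E' f) (hslant : IsProperPointwiseSlant E S f)
    (hξ : ∀ p : M, S.ξ (f p) ∈ tangentImage E E' f p) (p : M) :
    (S.etaForm.pullback f : Form E M 1).wedge ((slantForm S hf).wedgePow m) p ≠ 0 := by
  obtain ⟨ξ, hξp⟩ := hξ p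
  let ηp : TangentSpace 𝓘(ℝ, E) p →ₗ[ℝ] ℝ :=
    ((S.η (f p)).comp (mfderiv 𝓘(ℝ, E) 𝓘(ℝ, E') f p)).toLinearMap
  have hη1 : ηp ξ = 1 := (congrArg (S.η (f p)) hξp).trans (S.η_ξ (f p))
  have halt : ∀ X : TangentSpace 𝓘(ℝ, E) p, slantBilin S f p X X = 0 := fun X => S.inner_self_φ (f p) _
  have hanti : ∀ X Y : TangentSpace 𝓘(ℝ, E) p,
      slantBilin S f p X Y = - slantBilin S f p Y X := fun X Y => by
    have := halt (X + Y)
    simp only [map_add, LinearMap.add_apply, halt] at this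
    linarith
  -- A functional has rank at most one, so its kernel loses at most one dimension out of `2m + 1`.
  have hrank : 2 * m ≤ Module.finrank ℝ (LinearMap.ker ηp) := by
    have h1 := LinearMap.finrank_range_add_finrank_ker ηp
    have h2 := Submodule.finrank_le (LinearMap.range ηp)
    have h3 : Module.finrank ℝ (TangentSpace 𝓘(ℝ, E) p) = 2 * m + 1 := hm
    rw [Module.finrank_self] at h2
    omega
  obtain ⟨b, hbU, hb⟩ := exists_symplectic_family (slantBilin S f p) halt m (LinearMap.ker ηp)
    hrank fun X hX hX0 => by
      obtain ⟨Y, hY, hYX⟩ := slantBilin_nondegenerate S hf hslant p X hX hX0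
      exact ⟨Y, hY, by rwa [hanti, neg_ne_zero]⟩
  refine wedge_wedgePow_ne_zero (S.etaForm.pullback f p) (slantForm S hf p)
    (b := fun x => x.elim ξ b) hη1 (fun q => hbU q) fun i j s t => ?_
  rw [← hb i j s t]
  exact inner_tangentialPart S hf p _ _

end SlantForms

end PointwiseSlant

open PointwiseSlant
theorem theorem5p4 (m n : ℕ)
    {M : Type*} [TopologicalSpace M] [ChartedSpace (EuclideanSpace ℝ (Fin (2 * m + 1))) M]
    [IsManifold (𝓡 (2 * m + 1)) ∞ M] [T2Space M] [CompactSpace M] [Nonempty M]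
    {N : Type*} [TopologicalSpace N] [ChartedSpace (EuclideanSpace ℝ (Fin (2 * n + 1))) N]
    [IsManifold (𝓡 (2 * n + 1)) ∞ N] [T2Space N] [SecondCountableTopology N]
    [Bundle.RiemannianBundle (fun x : N => TangentSpace (𝓡 (2 * n + 1)) x)]
    [IsContMDiffRiemannianBundle (𝓡 (2 * n + 1)) ∞ (EuclideanSpace ℝ (Fin (2 * n + 1)))
      (fun x : N => TangentSpace (𝓡 (2 * n + 1)) x)]
    (S : AlmostContactMetricStructure (EuclideanSpace ℝ (Fin (2 * n + 1))) N)
    (hS : S.IsCosymplectic)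
    (f : M → N)
    (hf : IsSmoothImmersion (EuclideanSpace ℝ (Fin (2 * m + 1)))
      (EuclideanSpace ℝ (Fin (2 * n + 1))) f)
    (hslant : IsProperPointwiseSlant (EuclideanSpace ℝ (Fin (2 * m + 1))) S f)
    (hξ : ∀ p : M, S.ξ (f p) ∈ tangentImage (EuclideanSpace ℝ (Fin (2 * m + 1)))
      (EuclideanSpace ℝ (Fin (2 * n + 1))) f p) :
    (∃ hη : (S.etaForm.pullback f) ∈ closedForms (EuclideanSpace ℝ (Fin (2 * m + 1))) M 1,
      deRhamClass (S.etaForm.pullback f) hη ≠ 0) ∧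
    (∃ hΩ : slantForm S hf ∈ closedForms (EuclideanSpace ℝ (Fin (2 * m + 1))) M 2,
      1 ≤ m → deRhamClass (slantForm S hf) hΩ ≠ 0) ∧
    ((S.etaForm.pullback f).wedge ((slantForm S hf).wedgePow m) ∈
        smoothForms (EuclideanSpace ℝ (Fin (2 * m + 1))) M (1 + 2 * m) ∧
      ∀ p : M, (S.etaForm.pullback f).wedge ((slantForm S hf).wedgePow m) p ≠ 0) ∧
    ∀ i : ℕ, i ≤ 2 * m + 1 →
      Nontrivial (DeRhamCohomology (EuclideanSpace ℝ (Fin (2 * m + 1))) M i) := by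

  have hη : (S.etaForm.pullback f) ∈ closedForms (EuclideanSpace ℝ (Fin (2 * m + 1))) M 1 :=
    Form.pullback_mem_closedForms hS.closed_η hf.contMDiff
  have hΩ : slantForm S hf ∈ closedForms (EuclideanSpace ℝ (Fin (2 * m + 1))) M 2 := by
    rw [slantForm_eq_pullback]
    exact Form.pullback_mem_closedForms hS.closed_Φ hf.contMDiff
  have hne := eta_wedge_slantForm_ne_zero S finrank_euclideanSpace_fin hf hslant hξ
  have hm : Module.finrank ℝ (EuclideanSpace ℝ (Fin (2 * m + 1))) = 1 + 2 * m :=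
    finrank_euclideanSpace_fin.trans (Nat.add_comm _ _)
  exact ⟨⟨hη, (deRhamClass_ne_zero_iff hη).2 (notMem_exactForms_one hm hΩ hne)⟩,
    ⟨hΩ, fun h1m => (deRhamClass_ne_zero_iff hΩ).2 (notMem_exactForms_two hm hη hΩ hne h1m)⟩,
    ⟨Form.wedge_mem_smoothForms hη.1 (Form.wedgePow_two_mem_closedForms hΩ m).1, hne⟩,
    fun i hi => nontrivial_deRhamCohomology hm hη hΩ hne hi⟩
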